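/- Let $\mathcal J$ be the set of Jacobi matrices $(Ju)_n=a_nu_{n+1}+a_{n-1}u_{n-1}+b_nu_n$ ($n\in\mathbb Z$) with bounded real coefficients $a_n>0$, $b_n\in\mathbb R$, viewed as bounded self-adjoint operators on $\ell^2(\mathbb Z)$; $\|\cdot\|$ denotes the operator norm. For a bounded operator $X$ with matrix elements $X_{jk}=\langle\delta_j,X\delta_k\rangle$, let $X_a$ be the (possibly unbounded) infinite matrix with $(X_a)_{jk}=X_{jk}$ for $j<k$, $(X_a)_{jk}=-X_{jk}$ for $j>k$, and $(X_a)_{jj}=0$. For $f\in C^2(\mathbb R)$ (real-valued) and $J\in\mathcal J$, let $X_f(J)$ be the bounded tridiagonal operator with matrix elements $X_f(J)_{jk}=(f(J)_aJ-Jf(J)_a)_{jk}$ for $|j-k|\le 1$ (products of infinite matrices, row times column), and $X_f(J)_{jk}=0$ for $|j-k|>1$. For every $f\in C^2(\mathbb R)$ and every $J\in\mathcal J$ the Lax equation $\dot J=X_f(J)$ (derivative with respect to the operator norm) has a unique global solution $J(t)\in\mathcal J$, $t\in\mathbb R$, with $J(0)=J$. Write $\varphi_f^t(J)=J(t)$ for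 this generalized Toda flow and $f\cdot J=\varphi_f^1(J)$ for its time-one map. Then: 1. If $J\in\mathcal J$, $f,f_n\in C^2(\mathbb R)$ ($n\in\mathbb N$), and $f_n(x)\to f(x)$ uniformly on $|x|\le\|J\|$, then $\|f_n\cdot J-f\cdot J\|\to 0$. 2. The generalized Toda flows commute with each other and with the shift: $\varphi_f^s(\varphi_g^t(J))=\varphi_g^t(\varphi_f^s(J))$ and $\varphi_f^t(S_mJ)=S_m\varphi_f^t(J)$ for all $f,g\in C^2(\mathbb R)$, $s,t\in\mathbb R$, $m\in\mathbb Z$, $J\in\mathcal J$, where $S_mJ$ has the coefficients $(a_{n+m},b_{n+m})$. Moreover $0\cdot J=J$ and $(f+g)\cdot J=f\cdot(g\cdot J)$, so that the abelian group $C^2(\mathbb R)\times\mathbb Z$ acts on $\mathcal J$. -/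

import Mathlib

open Filter Topology

noncomputable section

namespace Toda

/-- The complex Hilbert space `ℓ²(ℤ)`. -/
abbrev Ell2 : Type := lp (fun _ : ℤ => ℂ) 2

/-- The standard unit vector `δ_n` of `ℓ²(ℤ)`. -/
def delta (n : ℤ) : Ell2 := lp.single 2 n (1 : ℂ)

/-- The function `f(T)` of a bounded self-adjoint operator `T` on a Hilbert space, given by the
continuous functional calculus. -/
def funCalc {H : Type*} [NormedAddCommGroup H] [InnerProductSpace ℂ H] [CompleteSpace H]
    (f : ℝ → ℝ) (T : H →L[ℂ] H) : H →L[ℂ] H := cfc f T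

/-- The matrix elements `X_{jk} = ⟨δ_j, X δ_k⟩` of a bounded operator on `ℓ²(ℤ)`. -/
def entry (X : Ell2 →L[ℂ] Ell2) (j k : ℤ) : ℂ := inner ℂ (delta j) (X (delta k))

lemma norm_delta (n : ℤ) : ‖delta n‖ = 1 := by
  unfold delta
  rw [lp.norm_single (by norm_num)]
  simp

lemma norm_entry_le (X : Ell2 →L[ℂ] Ell2) (j k : ℤ) : ‖entry X j k‖ ≤ ‖X‖ := by
  refine (norm_inner_le_norm _ _).trans ?_
  rw [norm_delta, one_mul]
  simpa [norm_delta] using X.le_opNorm (delta k)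

lemma summable_sq (u : Ell2) : Summable fun n : ℤ => ‖u n‖ ^ 2 := by
  simpa using (lp.memℓp u).summable (by norm_num)

lemma norm_sq_eq (u : Ell2) : ‖u‖ ^ 2 = ∑' n : ℤ, ‖u n‖ ^ 2 := by
  simpa using lp.norm_rpow_eq_tsum (p := 2) (by norm_num) u

lemma weightedShift_bound {c : ℤ → ℂ} {C : ℝ} (hc : ∀ n, ‖c n‖ ≤ C) (d : ℤ) (u : Ell2) (n : ℤ) :
    ‖c n * u (n + d)‖ ^ 2 ≤ C ^ 2 * ‖u (n + d)‖ ^ 2 := by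
  rw [norm_mul, mul_pow]
  gcongr
  exact hc n

lemma summable_sq_shift (d : ℤ) (u : Ell2) : Summable fun n : ℤ => ‖u (n + d)‖ ^ 2 :=
  (Equiv.addRight d).summable_iff.2 (summable_sq u)

lemma weightedShift_summable {c : ℤ → ℂ} {C : ℝ} (hc : ∀ n, ‖c n‖ ≤ C) (d : ℤ) (u : Ell2) :
    Summable fun n : ℤ => ‖c n * u (n + d)‖ ^ 2 :=
  Summable.of_nonneg_of_le (fun n => by positivity)
    (fun n => weightedShift_bound hc d u n) ((summable_sq_shift d u).mul_left (C ^ 2))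

lemma weightedShift_mem (c : ℤ → ℂ) (hc : ∃ C, ∀ n, ‖c n‖ ≤ C) (d : ℤ) (u : Ell2) :
    Memℓp (fun n : ℤ => c n * u (n + d)) 2 := by
  obtain ⟨C, hC⟩ := hc
  refine memℓp_gen ?_
  simpa using weightedShift_summable hC d u

/-- The linear map underlying `weightedShift`. -/
def weightedShiftLin (c : ℤ → ℂ) (hc : ∃ C, ∀ n, ‖c n‖ ≤ C) (d : ℤ) : Ell2 →ₗ[ℂ] Ell2 where
  toFun := fun u => ⟨fun n : ℤ => c n * u (n + d), weightedShift_mem c hc d u⟩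
  map_add' := fun u v => Subtype.ext (funext fun n => mul_add (c n) (u (n + d)) (v (n + d)))
  map_smul' := fun z u => Subtype.ext (funext fun n => mul_left_comm (c n) z (u (n + d)))

lemma weightedShiftLin_apply (c : ℤ → ℂ) (hc : ∃ C, ∀ n, ‖c n‖ ≤ C) (d : ℤ) (u : Ell2) (n : ℤ) :
    weightedShiftLin c hc d u n = c n * u (n + d) := rfl

lemma weightedShiftLin_bound (c : ℤ → ℂ) (hc : ∃ C, ∀ n, ‖c n‖ ≤ C) (d : ℤ) :
    ∃ C, ∀ u, ‖weightedShiftLin c hc d u‖ ≤ C * ‖u‖ := by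
  obtain ⟨C, hC⟩ := id hc
  have hC0 : 0 ≤ C := (norm_nonneg _).trans (hC 0)
  refine ⟨C, fun u => ?_⟩
  have h : ‖weightedShiftLin c hc d u‖ ^ 2 ≤ (C * ‖u‖) ^ 2 := by
    rw [norm_sq_eq, mul_pow, norm_sq_eq, ← (Equiv.addRight d).tsum_eq (fun n : ℤ => ‖u n‖ ^ 2),
      ← tsum_mul_left]
    exact Summable.tsum_le_tsum (fun n => weightedShift_bound hC d u n)
      (weightedShift_summable hC d u) ((summable_sq_shift d u).mul_left _)
  exact (sq_le_sq₀ (norm_nonneg _) (by positivity)).1 h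

/-- The bounded operator `(T u)_n = c_n u_{n+d}` on `ℓ²(ℤ)`, for a bounded sequence `c`. -/
def weightedShift (c : ℤ → ℂ) (hc : ∃ C, ∀ n, ‖c n‖ ≤ C) (d : ℤ) : Ell2 →L[ℂ] Ell2 :=
  (weightedShiftLin c hc d).mkContinuousOfExistsBound (weightedShiftLin_bound c hc d)

lemma weightedShift_apply (c : ℤ → ℂ) (hc : ∃ C, ∀ n, ‖c n‖ ≤ C) (d : ℤ) (u : Ell2) (n : ℤ) :
    weightedShift c hc d u n = c n * u (n + d) := rfl

/-- The bounded operator on `ℓ²(ℤ)` that acts as the tridiagonal part of the infinite matrix `M`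
with bounded entries: `(T u)_n = M_{n,n-1} u_{n-1} + M_{n,n} u_n + M_{n,n+1} u_{n+1}`. -/
def tridiagOp (M : ℤ → ℤ → ℂ) (hM : ∃ C, ∀ j k, ‖M j k‖ ≤ C) : Ell2 →L[ℂ] Ell2 :=
  weightedShift (fun n => M n (n + 1)) (hM.imp fun _ h n => h n (n + 1)) 1
    + weightedShift (fun n => M n (n - 1)) (hM.imp fun _ h n => h n (n - 1)) (-1)
    + weightedShift (fun n => M n n) (hM.imp fun _ h n => h n n) 0

lemma tridiagOp_apply (M : ℤ → ℤ → ℂ) (hM : ∃ C, ∀ j k, ‖M j k‖ ≤ C) (u : Ell2) (n : ℤ) :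
    tridiagOp M hM u n = M n (n + 1) * u (n + 1) + M n (n - 1) * u (n - 1) + M n n * u n := by
  have h : tridiagOp M hM u n
      = M n (n + 1) * u (n + 1) + M n (n - 1) * u (n + -1) + M n n * u (n + 0) := rfl
  rw [h, add_zero, ← sub_eq_add_neg]

/-- A Jacobi matrix, given by its coefficients: bounded real sequences `a`, `b` with `a_n > 0`. -/
@[ext]
structure Jacobi where
  a : ℤ → ℝ
  b : ℤ → ℝ
  a_pos : ∀ n, 0 < a n
  a_bdd : ∃ C, ∀ n, |a n| ≤ C
  b_bdd : ∃ C, ∀ n, |b n| ≤ C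

namespace Jacobi

/-- The infinite symmetric tridiagonal matrix with `b` on the diagonal and
`a_n` in the positions `(n, n+1)` and `(n+1, n)`. -/
def mat (J : Jacobi) (j k : ℤ) : ℂ :=
  if k = j + 1 then (J.a j : ℂ)
  else if j = k + 1 then (J.a k : ℂ)
  else if j = k then (J.b j : ℂ)
  else 0

lemma mat_bdd (J : Jacobi) : ∃ C, ∀ j k, ‖J.mat j k‖ ≤ C := by
  obtain ⟨A, hA⟩ := J.a_bdd
  obtain ⟨B, hB⟩ := J.b_bdd
  have hA0 : 0 ≤ A := (abs_nonneg _).trans (hA 0)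
  have hB0 : 0 ≤ B := (abs_nonneg _).trans (hB 0)
  refine ⟨A + B, fun j k => ?_⟩
  have h1 := hA j
  have h2 := hA k
  have h3 := hB j
  unfold mat
  split_ifs <;> simp only [Complex.norm_real, Real.norm_eq_abs, norm_zero] <;> linarith

/-- The Jacobi matrix as a bounded operator on `ℓ²(ℤ)`. -/
def op (J : Jacobi) : Ell2 →L[ℂ] Ell2 := tridiagOp J.mat J.mat_bdd

lemma op_apply (J : Jacobi) (u : Ell2) (n : ℤ) :
    J.op u n = J.a n * u (n + 1) + J.a (n - 1) * u (n - 1) + J.b n * u n := by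
  rw [op, tridiagOp_apply]
  have h1 : J.mat n (n + 1) = J.a n := by simp [mat]
  have h2 : J.mat n (n - 1) = J.a (n - 1) := by
    unfold mat
    rw [if_neg (by omega), if_pos (by omega)]
  have h3 : J.mat n n = J.b n := by simp [mat]
  rw [h1, h2, h3]

/-- The shift by `m`: the coefficients `(a_n, b_n)` are replaced by `(a_{n+m}, b_{n+m})`. -/
def shift (m : ℤ) (J : Jacobi) : Jacobi where
  a := fun n => J.a (n + m)
  b := fun n => J.b (n + m)
  a_pos := fun n => J.a_pos (n + m)
  a_bdd := J.a_bdd.imp fun _ h n => h (n + m)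
  b_bdd := J.b_bdd.imp fun _ h n => h (n + m)

end Jacobi

/-- The matrix of the anti-symmetric part `X_a` of an operator: the matrix elements above the
diagonal are kept, those below change their sign, and those on the diagonal become zero. -/
def antisymm (X : Ell2 →L[ℂ] Ell2) (j k : ℤ) : ℂ :=
  if j < k then entry X j k else if k < j then -entry X j k else 0

lemma norm_antisymm_le (X : Ell2 →L[ℂ] Ell2) (j k : ℤ) : ‖antisymm X j k‖ ≤ ‖X‖ := by
  unfold antisymm
  split_ifs
  · exact norm_entry_le X j k
  · rw [norm_neg]
    exact norm_entry_le X j k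
  · simp

/-- The matrix element `(A J - J A)_{jk}` of the commutator of an arbitrary infinite matrix `A` and
a Jacobi matrix, multiplied row times column. Since `J_{lm} = 0` for `|l - m| > 1`, all the terms
of the two (formally infinite) sums that are not listed here are zero. -/
def commEntry (A : ℤ → ℤ → ℂ) (J : Jacobi) (j k : ℤ) : ℂ :=
  (∑ l ∈ Finset.Icc (k - 1) (k + 1), A j l * J.mat l k)
    - ∑ l ∈ Finset.Icc (j - 1) (j + 1), J.mat j l * A l k

/-- The matrix elements of `X_f(J)`: those of `[f(J)_a, J]` on the three central diagonals, and
zero elsewhere. Here `f(J)` is given by the functional calculus of the self-adjoint operator `J`. -/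
def laxMat (f : ℝ → ℝ) (J : Jacobi) (j k : ℤ) : ℂ :=
  if |j - k| ≤ 1 then commEntry (antisymm (funCalc f J.op)) J j k else 0

lemma laxMat_bdd (f : ℝ → ℝ) (J : Jacobi) : ∃ C, ∀ j k, ‖laxMat f J j k‖ ≤ C := by
  obtain ⟨C, hC⟩ := J.mat_bdd
  have hC0 : 0 ≤ C := (norm_nonneg _).trans (hC 0 0)
  set F := ‖funCalc f J.op‖ with hF
  have hF0 : 0 ≤ F := norm_nonneg _
  have hcard : ∀ m : ℤ, (Finset.Icc (m - 1) (m + 1)).card = 3 := fun m => by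
    rw [Int.card_Icc]
    omega
  refine ⟨3 * (F * C) + 3 * (C * F), fun j k => ?_⟩
  unfold laxMat commEntry
  split_ifs
  · refine (norm_sub_le _ _).trans (add_le_add ?_ ?_)
    · refine (norm_sum_le_of_le _ (f := fun l => antisymm (funCalc f J.op) j l * J.mat l k)
        (n := fun _ => F * C) fun l _ => ?_).trans ?_
      · rw [norm_mul]
        exact mul_le_mul (norm_antisymm_le _ _ _) (hC _ _) (norm_nonneg _) hF0
      · simp [hcard]
    · refine (norm_sum_le_of_le _ (f := fun l => J.mat j l * antisymm (funCalc f J.op) l k)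
        (n := fun _ => C * F) fun l _ => ?_).trans ?_
      · rw [norm_mul]
        exact mul_le_mul (hC _ _) (norm_antisymm_le _ _ _) (norm_nonneg _) hC0
      · simp [hcard]
  · rw [norm_zero]
    positivity

/-- The right-hand side `X_f(J)` of the Lax equation, a bounded tridiagonal operator. -/
def laxField (f : ℝ → ℝ) (J : Jacobi) : Ell2 →L[ℂ] Ell2 := tridiagOp (laxMat f J) (laxMat_bdd f J)

/-- `γ` is a global solution of the Lax equation `dJ/dt = X_f(J)` with the initial value `J`; it
takes values in the Jacobi matrices, and the derivative is taken in the operator norm. -/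
def IsLaxSolution (f : ℝ → ℝ) (J : Jacobi) (γ : ℝ → Jacobi) : Prop :=
  γ 0 = J ∧ ∀ t : ℝ, HasDerivAt (fun s : ℝ => (γ s).op) (laxField f (γ t)) t

open Classical in
/-- The generalized Toda flow: `todaFlow f t J` is the value at time `t` of the global solution of
the Lax equation that starts at `J` (and `J` itself if there is no such solution). -/
def todaFlow (f : ℝ → ℝ) (t : ℝ) (J : Jacobi) : Jacobi :=
  if h : ∃ γ : ℝ → Jacobi, IsLaxSolution f J γ then h.choose t else J

/-- The time-one map `f · J` of the generalized Toda flow. -/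
def act (f : ℝ → ℝ) (J : Jacobi) : Jacobi := todaFlow f 1 J

end Toda

end

noncomputable section

namespace Toda

/-! The flow has an explicit form, a QR factorization. The operator `G = exp f(J)` is positive,
invertible and commutes with `J`. Gram-Schmidt applied to the vectors `G δ_n`, started at `n = -∞`,
gives an orthonormal basis `q_n`, and `qrFlow f J` is the matrix of `J` in that basis. It is again a
Jacobi matrix (`gsJacobi_mat`): since `J` commutes with `G`, it raises the flag of subspaces `G
(flag n)` by one step only, and a self-adjoint matrix with this property is tridiagonal.

Gram-Schmidt vectors are unique, so composing two factorizations gives the factorization of the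
product. With `exp f(J) exp g(J) = exp (f + g)(J)` this is the group law `qrFlow_qrFlow`, which
contains commutativity and the action property.

Expanding `q_n` to first order in `F = f(J)` produces minus the antisymmetric part of `F`. Hence
`qrFlow f J - J` is the Lax field up to an error quadratic in `‖f(J)‖` (`norm_qrFlow_op_sub_le`).
The group law moves this expansion at `0` to any time, so `t ↦ qrFlow (t • f) J` solves the Lax
equation. Applied to `f_n - f` at the point `f · J`, whose norm is `‖J‖`, the same expansion gives
the continuity in `f`.

Uniqueness is Grönwall's inequality, once the Lax field is Lipschitz on bounded sets. For this, a
`C²` function is written on a bounded interval as a Fourier series with `∑ |n| |c_n| < ∞`, and each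
exponential is operator Lipschitz (`exists_lipschitz_funCalc`). Uniqueness identifies `todaFlow`
with `qrFlow` and also gives the commutation with the shift, because a shifted solution is a
solution. -/

lemma inner_delta_left (k : ℤ) (u : Ell2) : inner ℂ (delta k) u = u k := by
  simp [delta, lp.inner_single_left]

lemma inner_delta_right (k : ℤ) (u : Ell2) : inner ℂ u (delta k) = (starRingEnd ℂ) (u k) := by
  rw [← inner_conj_symm, inner_delta_left]

lemma delta_apply (n k : ℤ) : delta n k = if k = n then 1 else 0 := by
  rcases eq_or_ne k n with h | h
  · subst h; simp [delta]
  · rw [if_neg h]; simp [delta, h]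

lemma hasSum_delta (u : Ell2) : HasSum (fun k : ℤ => u k • delta k) u := by
  have h := lp.hasSum_single (p := 2) (by norm_num) u
  convert h using 2 with k
  rw [delta, ← lp.single_smul]
  simp

lemma ext_entry {X Y : Ell2 →L[ℂ] Ell2} (h : ∀ j k, entry X j k = entry Y j k) : X = Y := by
  have h1 : ∀ k, X (delta k) = Y (delta k) := fun k => by
    ext j
    have := h j k
    simpa only [entry, inner_delta_left] using this
  ext1 u
  have hX := (hasSum_delta u).mapL X
  have hY := (hasSum_delta u).mapL Y
  simp only [map_smul, h1] at hX hY
  exact hX.unique hY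

/-! ### The flag of coordinate subspaces and its images -/

/-- The closed span of the `δ_k` with `k < n`. -/
def flag (n : ℤ) : Submodule ℂ Ell2 where
  carrier := {u | ∀ k, n ≤ k → u k = 0}
  add_mem' := fun {u v} hu hv k hk => by
    rw [lp.coeFn_add, Pi.add_apply, hu k hk, hv k hk, add_zero]
  zero_mem' := fun k _ => rfl
  smul_mem' := fun c u hu k hk => by
    rw [lp.coeFn_smul, Pi.smul_apply, hu k hk, smul_zero]

lemma mem_flag {n : ℤ} {u : Ell2} : u ∈ flag n ↔ ∀ k, n ≤ k → u k = 0 := Iff.rfl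

lemma continuous_coord (k : ℤ) : Continuous fun u : Ell2 => u k := by
  simp_rw [← inner_delta_left]
  fun_prop

lemma isClosed_flag (n : ℤ) : IsClosed (flag n : Set Ell2) := by
  have : (flag n : Set Ell2) = ⋂ k : ℤ, ⋂ _ : n ≤ k, {u : Ell2 | u k = 0} := by
    ext u; simp [mem_flag]
  rw [this]
  exact isClosed_iInter fun k => isClosed_iInter fun _ =>
    isClosed_eq (continuous_coord k) continuous_const

lemma flag_mono {m n : ℤ} (h : m ≤ n) : flag m ≤ flag n := fun _ hu k hk => hu k (h.trans hk)

lemma delta_mem_flag {m n : ℤ} (h : m < n) : delta m ∈ flag n := fun k hk => by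
  rw [delta_apply, if_neg (by omega)]

/-- The image of `flag n` under the invertible operator `G`. -/
def flagMap (G : (Ell2 →L[ℂ] Ell2)ˣ) (n : ℤ) : Submodule ℂ Ell2 :=
  (flag n).comap ((G⁻¹ : (Ell2 →L[ℂ] Ell2)ˣ) : Ell2 →L[ℂ] Ell2).toLinearMap

/-! ### Gram-Schmidt orthonormalization started at minus infinity -/

section GramSchmidt

variable (G : (Ell2 →L[ℂ] Ell2)ˣ)

lemma mem_flagMap {G : (Ell2 →L[ℂ] Ell2)ˣ} {n : ℤ} {u : Ell2} :
    u ∈ flagMap G n ↔ G⁻¹.val u ∈ flag n := Iff.rfl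

lemma inv_apply_self (u : Ell2) : G⁻¹.val (G.val u) = u := by
  rw [← mul_apply_eq_comp, Units.inv_mul, one_apply_eq_self]

lemma apply_inv_self (u : Ell2) : G.val (G⁻¹.val u) = u := by
  rw [← mul_apply_eq_comp, Units.mul_inv, one_apply_eq_self]

lemma apply_mem_flagMap {n : ℤ} {u : Ell2} : G.val u ∈ flagMap G n ↔ u ∈ flag n := by
  rw [mem_flagMap, inv_apply_self]

lemma isClosed_flagMap (n : ℤ) : IsClosed (flagMap G n : Set Ell2) :=
  (isClosed_flag n).preimage (G⁻¹.val).continuous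

instance (n : ℤ) : CompleteSpace (flagMap G n) := (isClosed_flagMap G n).completeSpace_coe

lemma flagMap_mono {m n : ℤ} (h : m ≤ n) : flagMap G m ≤ flagMap G n :=
  fun _ hu => flag_mono h hu

/-- The component of `G δ_n` orthogonal to `G (flag n)`. -/
def gsRes (n : ℤ) : Ell2 :=
  G.val (delta n) - (flagMap G n).starProjection (G.val (delta n))

lemma gsRes_mem_orthogonal (n : ℤ) : gsRes G n ∈ (flagMap G n)ᗮ :=
  (flagMap G n).sub_starProjection_mem_orthogonal _

lemma gsRes_mem (n : ℤ) : gsRes G n ∈ flagMap G (n + 1) :=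
  sub_mem ((apply_mem_flagMap G).2 (delta_mem_flag (by omega)))
    (flagMap_mono G (by omega) (Submodule.starProjection_apply_mem _ _))

lemma gsRes_ne_zero (n : ℤ) : gsRes G n ≠ 0 := by
  intro h
  have h1 : G.val (delta n) ∈ flagMap G n := by
    rw [sub_eq_zero.1 h]
    exact Submodule.starProjection_apply_mem _ _
  have := (apply_mem_flagMap G).1 h1 n le_rfl
  simp [delta_apply] at this

/-- The Gram-Schmidt vectors of `(G δ_n)_{n ∈ ℤ}`, started at `n = -∞`. -/
def gsVec (n : ℤ) : Ell2 := ((‖gsRes G n‖⁻¹ : ℝ) : ℂ) • gsRes G n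

lemma norm_gsVec (n : ℤ) : ‖gsVec G n‖ = 1 := by
  rw [gsVec, norm_smul, Complex.norm_real, norm_inv, norm_norm]
  exact inv_mul_cancel₀ (norm_ne_zero_iff.2 (gsRes_ne_zero G n))

lemma gsVec_mem_orthogonal (n : ℤ) : gsVec G n ∈ (flagMap G n)ᗮ :=
  Submodule.smul_mem _ _ (gsRes_mem_orthogonal G n)

lemma gsVec_mem (n : ℤ) : gsVec G n ∈ flagMap G (n + 1) :=
  Submodule.smul_mem _ _ (gsRes_mem G n)

lemma smul_gsVec (n : ℤ) : (‖gsRes G n‖ : ℂ) • gsVec G n = gsRes G n := by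
  rw [gsVec, smul_smul, ← Complex.ofReal_mul,
    mul_inv_cancel₀ (norm_ne_zero_iff.2 (gsRes_ne_zero G n)), Complex.ofReal_one, one_smul]

/-- `G δ_n` is a positive multiple of the `n`-th Gram-Schmidt vector, up to `G (flag n)`. -/
lemma exists_apply_delta_eq (n : ℤ) : ∃ m ∈ flagMap G n,
    G.val (delta n) = (‖gsRes G n‖ : ℂ) • gsVec G n + m :=
  ⟨_, Submodule.starProjection_apply_mem _ (G.val (delta n)), by
    rw [smul_gsVec, gsRes, sub_add_cancel]⟩

lemma inner_gsVec_eq_zero {n : ℤ} {u : Ell2} (hu : u ∈ flagMap G n) :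
    inner ℂ (gsVec G n) u = 0 :=
  (Submodule.mem_orthogonal' _ _).1 (gsVec_mem_orthogonal G n) u hu

lemma inner_gsVec_self (n : ℤ) : inner ℂ (gsVec G n) (gsVec G n) = 1 := by
  rw [inner_self_eq_norm_sq_to_K, norm_gsVec]; simp

lemma inner_gsVec_apply_delta (n : ℤ) :
    inner ℂ (gsVec G n) (G.val (delta n)) = (‖gsRes G n‖ : ℂ) := by
  obtain ⟨m, hm, h⟩ := exists_apply_delta_eq G n
  rw [h, inner_add_right, inner_gsVec_eq_zero G hm, inner_smul_right, inner_gsVec_self]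
  simp

lemma orthonormal_gsVec : Orthonormal ℂ (gsVec G) := by
  refine ⟨norm_gsVec G, fun m n hmn => ?_⟩
  rcases lt_or_gt_of_ne hmn with h | h
  · rw [← inner_conj_symm, inner_gsVec_eq_zero G (flagMap_mono G (by omega) (gsVec_mem G m)),
      map_zero]
  · exact inner_gsVec_eq_zero G (flagMap_mono G (by omega) (gsVec_mem G n))

lemma flag_succ_decomp {n : ℤ} {u : Ell2} (hu : u ∈ flag (n + 1)) : u - u n • delta n ∈ flag n := by
  intro k hk
  rw [lp.coeFn_sub, Pi.sub_apply, lp.coeFn_smul, Pi.smul_apply, delta_apply]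
  rcases hk.eq_or_lt with h | h
  · subst h; simp
  · rw [hu k (by omega), if_neg (by omega)]; simp

lemma flagMap_succ_decomp {n : ℤ} {u : Ell2} (hu : u ∈ flagMap G (n + 1)) :
    ∃ c : ℂ, u - c • gsVec G n ∈ flagMap G n := by
  obtain ⟨m, hm, h⟩ := exists_apply_delta_eq G n
  set c := (G⁻¹.val u) n
  refine ⟨c * ‖gsRes G n‖, ?_⟩
  have h1 : u - c • G.val (delta n) ∈ flagMap G n := by
    rw [mem_flagMap, map_sub, map_smul, inv_apply_self]
    exact flag_succ_decomp hu
  have h2 : u - (c * ‖gsRes G n‖) • gsVec G n = (u - c • G.val (delta n)) + c • m := by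
    rw [h, mul_smul, smul_add]; abel
  rw [h2]
  exact add_mem h1 (Submodule.smul_mem _ _ hm)

/-- A unit vector in `G (flag (n + 1))` orthogonal to `G (flag n)` and with a positive component
along `G δ_n` is the `n`-th Gram-Schmidt vector. -/
lemma eq_gsVec {n : ℤ} {v : Ell2} (h1 : v ∈ flagMap G (n + 1)) (h2 : v ∈ (flagMap G n)ᗮ)
    (h3 : ‖v‖ = 1) {r : ℝ} (hr : 0 < r) (h4 : inner ℂ v (G.val (delta n)) = r) :
    v = gsVec G n := by
  obtain ⟨c, hc⟩ := flagMap_succ_decomp G h1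
  have h5 : v - c • gsVec G n = 0 := by
    refine inner_self_eq_zero (𝕜 := ℂ).1 ?_
    exact (Submodule.mem_orthogonal' _ _).1 (sub_mem h2
      (Submodule.smul_mem _ _ (gsVec_mem_orthogonal G n))) _ hc
  rw [sub_eq_zero] at h5
  have hc1 : ‖c‖ = 1 := by
    rw [h5, norm_smul, norm_gsVec, mul_one] at h3; exact h3
  rw [h5, inner_smul_left, inner_gsVec_apply_delta] at h4
  have hg : 0 < ‖gsRes G n‖ := norm_pos_iff.2 (gsRes_ne_zero G n)
  have h6 : (starRingEnd ℂ) c = ((r / ‖gsRes G n‖ : ℝ) : ℂ) := by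
    rw [Complex.ofReal_div, ← h4, mul_div_cancel_right₀]
    exact_mod_cast hg.ne'
  have h7 : c = ((r / ‖gsRes G n‖ : ℝ) : ℂ) := by
    rw [← Complex.conj_conj c, h6, Complex.conj_ofReal]
  rw [h7, Complex.norm_real, Real.norm_of_nonneg (by positivity)] at hc1
  rw [h5, h7, hc1, Complex.ofReal_one, one_smul]

lemma eq_zero_of_mem_flagMap {u : Ell2} (h : ∀ n, u ∈ flagMap G n) : u = 0 := by
  have : G⁻¹.val u = 0 := by
    ext k
    exact h k k le_rfl
  rw [← apply_inv_self G u, this, map_zero]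

lemma eq_zero_of_inner_delta {u : Ell2} (h : ∀ n, inner ℂ u (G.val (delta n)) = 0) : u = 0 := by
  have h1 := ((hasSum_delta (G⁻¹.val u)).mapL G.val).mapL (innerSL ℂ u)
  simp only [map_smul, innerSL_apply_apply, h, smul_zero, apply_inv_self] at h1
  exact inner_self_eq_zero (𝕜 := ℂ).1 (h1.unique hasSum_zero)

/-- Completeness is not automatic, as the orthonormalization has no first vector. If `x` is
orthogonal to every `gsVec G n`, its projections to consecutive subspaces `G (flag n)` agree, since
these differ by the line of one Gram-Schmidt vector. The common projection lies in the intersection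
of all `G (flag n)`, which is zero. So `x` is orthogonal to all `G δ_n`, and these span a dense
subspace. -/
lemma orthogonal_span_gsVec : (Submodule.span ℂ (Set.range (gsVec G)))ᗮ = ⊥ := by
  rw [Submodule.eq_bot_iff]
  intro x hx
  have hx' : ∀ n, inner ℂ (gsVec G n) x = 0 := fun n =>
    (Submodule.mem_orthogonal _ _).1 hx _ (Submodule.subset_span ⟨n, rfl⟩)
  set p : ℤ → Ell2 := fun n => (flagMap G n).starProjection x with hp
  have hpm : ∀ n, p n ∈ flagMap G n := fun n => Submodule.starProjection_apply_mem _ _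
  have hpo : ∀ n, x - p n ∈ (flagMap G n)ᗮ := fun n =>
    Submodule.sub_starProjection_mem_orthogonal _
  have hstep : ∀ n, p (n + 1) = p n := by
    intro n
    obtain ⟨c, hc⟩ := flagMap_succ_decomp G (hpm (n + 1))
    have h1 : p (n + 1) - p n ∈ (flagMap G n)ᗮ := by
      have := sub_mem (hpo n) (Submodule.orthogonal_le (flagMap_mono G (by omega)) (hpo (n + 1)))
      convert this using 1; abel
    have h2 : inner ℂ (p (n + 1) - p n) (gsVec G n) = 0 := by
      have h3 : inner ℂ (gsVec G n) (p n) = 0 := inner_gsVec_eq_zero G (hpm n)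
      have h4 : inner ℂ (gsVec G n) (x - p (n + 1)) = 0 :=
        (Submodule.mem_orthogonal _ _).1 (hpo (n + 1)) _ (gsVec_mem G n)
      rw [inner_sub_right, hx' n, zero_sub, neg_eq_zero] at h4
      rw [← inner_conj_symm, inner_sub_right, h3, h4]; simp
    rw [← sub_eq_zero]
    refine inner_self_eq_zero (𝕜 := ℂ).1 ?_
    have h3 : p (n + 1) - p n = (p (n + 1) - c • gsVec G n - p n) + c • gsVec G n := by abel
    conv_lhs => rw [h3, inner_add_right, inner_smul_right]
    rw [← h3, h2, mul_zero, add_zero]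
    exact (Submodule.mem_orthogonal' _ _).1 h1 _ (sub_mem hc (hpm n))
  have hconst : ∀ n, p n = p 0 := by
    intro n
    induction n using Int.induction_on with
    | zero => rfl
    | succ k ih => rw [hstep, ih]
    | pred k ih => rw [← ih, ← hstep, sub_add_cancel]
  have hp0 : p 0 = 0 := eq_zero_of_mem_flagMap G fun n => hconst n ▸ hpm n
  refine eq_zero_of_inner_delta G fun n => ?_
  have := hpo (n + 1)
  rw [hconst, hp0, sub_zero] at this
  exact (Submodule.mem_orthogonal' _ _).1 this _
    ((apply_mem_flagMap G).2 (delta_mem_flag (by omega)))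

/-- The unitary operator `δ_n ↦ gsVec G n`. -/
def gsUnitary : Ell2 ≃ₗᵢ[ℂ] Ell2 :=
  (HilbertBasis.mkOfOrthogonalEqBot (orthonormal_gsVec G) (orthogonal_span_gsVec G)).repr.symm

lemma gsUnitary_delta (n : ℤ) : gsUnitary G (delta n) = gsVec G n := by
  have := HilbertBasis.repr_symm_single
    (HilbertBasis.mkOfOrthogonalEqBot (orthonormal_gsVec G) (orthogonal_span_gsVec G)) n
  rw [HilbertBasis.coe_mkOfOrthogonalEqBot] at this
  exact this

lemma inner_gsUnitary_symm (u v : Ell2) :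
    inner ℂ u ((gsUnitary G).symm v) = inner ℂ (gsUnitary G u) v := by
  rw [← (gsUnitary G).inner_map_map u, LinearIsometryEquiv.apply_symm_apply]

lemma gsUnitary_symm_apply (u : Ell2) (n : ℤ) :
    (gsUnitary G).symm u n = inner ℂ (gsVec G n) u := by
  rw [← inner_delta_left, inner_gsUnitary_symm, gsUnitary_delta]

/-- `gsUnitary G` maps `flag n` onto `flagMap G n`. -/
lemma gsUnitary_mem {n : ℤ} {u : Ell2} (hu : u ∈ flag n) : gsUnitary G u ∈ flagMap G n := by
  have h := (hasSum_delta u).mapL ((gsUnitary G : Ell2 ≃L[ℂ] Ell2) : Ell2 →L[ℂ] Ell2)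
  refine (isClosed_flagMap G n).mem_of_tendsto h (Eventually.of_forall fun s => ?_)
  refine Submodule.sum_mem _ fun k _ => ?_
  rcases lt_or_ge k n with hk | hk
  · rw [map_smul]
    refine Submodule.smul_mem _ _ ?_
    change gsUnitary G (delta k) ∈ _
    rw [gsUnitary_delta]
    exact flagMap_mono G (by omega) (gsVec_mem G k)
  · rw [hu k hk, zero_smul, map_zero]; exact zero_mem _

lemma gsUnitary_symm_mem {n : ℤ} {u : Ell2} (hu : u ∈ flagMap G n) :
    (gsUnitary G).symm u ∈ flag n := fun k hk => by
  rw [gsUnitary_symm_apply, inner_gsVec_eq_zero G (flagMap_mono G hk hu)]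

end GramSchmidt

/-! ### Matrix elements and self-adjointness of Jacobi operators -/

lemma op_delta_apply (J : Jacobi) (j k : ℤ) : J.op (delta k) j = J.mat j k := by
  rw [Jacobi.op_apply]
  simp only [delta_apply, Jacobi.mat]
  split_ifs <;> first | omega | (subst_vars; simp)

lemma entry_op (J : Jacobi) (j k : ℤ) : entry J.op j k = J.mat j k := by
  rw [entry, inner_delta_left, op_delta_apply]

lemma mat_symm (J : Jacobi) (j k : ℤ) : J.mat j k = J.mat k j := by
  unfold Jacobi.mat
  split_ifs <;> first | omega | (subst_vars; rfl)

lemma conj_mat (J : Jacobi) (j k : ℤ) : (starRingEnd ℂ) (J.mat j k) = J.mat j k := by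
  unfold Jacobi.mat
  split_ifs <;> simp

lemma entry_star (X : Ell2 →L[ℂ] Ell2) (j k : ℤ) :
    entry (star X) j k = (starRingEnd ℂ) (entry X k j) := by
  rw [entry, entry, ContinuousLinearMap.star_eq_adjoint, ContinuousLinearMap.adjoint_inner_right,
    inner_conj_symm]

lemma isSelfAdjoint_op (J : Jacobi) : IsSelfAdjoint J.op :=
  ext_entry fun j k => by rw [entry_star, entry_op, entry_op, conj_mat, mat_symm]

lemma inner_op_left (J : Jacobi) (u v : Ell2) : inner ℂ (J.op u) v = inner ℂ u (J.op v) := by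
  conv_lhs => rw [← (isSelfAdjoint_op J).star_eq]
  rw [ContinuousLinearMap.star_eq_adjoint, ContinuousLinearMap.adjoint_inner_left]

lemma mat_succ (J : Jacobi) (n : ℤ) : J.mat (n + 1) n = J.a n := by
  rw [mat_symm]; simp [Jacobi.mat]

lemma mat_self (J : Jacobi) (n : ℤ) : J.mat n n = J.b n := by simp [Jacobi.mat]

lemma op_injective : Function.Injective Jacobi.op := by
  intro J K h
  have h1 : ∀ j k, J.mat j k = K.mat j k := fun j k => by rw [← entry_op, h, entry_op]
  refine Jacobi.ext (funext fun n => ?_) (funext fun n => ?_)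
  · have := h1 (n + 1) n
    rw [mat_succ, mat_succ] at this
    exact_mod_cast this
  · have := h1 n n
    rw [mat_self, mat_self] at this
    exact_mod_cast this

lemma op_mem_flag (J : Jacobi) {n : ℤ} {u : Ell2} (hu : u ∈ flag n) : J.op u ∈ flag (n + 1) := by
  intro k hk
  rw [Jacobi.op_apply, hu (k + 1) (by omega), hu (k - 1) (by omega), hu k (by omega)]
  simp

/-! ### A Jacobi operator in the Gram-Schmidt basis of a commuting operator -/

section Conj

variable (G : (Ell2 →L[ℂ] Ell2)ˣ) (J : Jacobi)

lemma op_mem_flagMap {G : (Ell2 →L[ℂ] Ell2)ˣ} {J : Jacobi} (hc : Commute G.val J.op) {n : ℤ}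
    {u : Ell2} (hu : u ∈ flagMap G n) : J.op u ∈ flagMap G (n + 1) := by
  rw [mem_flagMap]
  have h : G⁻¹.val (J.op u) = J.op (G⁻¹.val u) := by
    have := congrArg (fun T : Ell2 →L[ℂ] Ell2 => T u) hc.units_inv_left.eq
    simpa using this
  rw [h]
  exact op_mem_flag J hu

lemma inner_gsVec_op_eq_zero {G : (Ell2 →L[ℂ] Ell2)ˣ} {J : Jacobi} (hc : Commute G.val J.op)
    {j k : ℤ} (h : k + 2 ≤ j) : inner ℂ (gsVec G j) (J.op (gsVec G k)) = 0 :=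
  inner_gsVec_eq_zero G (flagMap_mono G (by omega) (op_mem_flagMap hc (gsVec_mem G k)))

/-- Modulo `G (flag (n + 1))`, the vector `J G δ_n = G J δ_n` equals `a_n G δ_{n+1}`. Comparing the
components along `gsVec G (n + 1)` on both sides gives the new off-diagonal coefficient as a
positive multiple of the old one. -/
lemma inner_gsVec_succ_op {G : (Ell2 →L[ℂ] Ell2)ˣ} {J : Jacobi} (hc : Commute G.val J.op) (n : ℤ) :
    inner ℂ (gsVec G (n + 1)) (J.op (gsVec G n))
      = ((J.a n * (‖gsRes G (n + 1)‖ / ‖gsRes G n‖) : ℝ) : ℂ) := by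
  have hpos : (‖gsRes G n‖ : ℂ) ≠ 0 := by exact_mod_cast norm_ne_zero_iff.2 (gsRes_ne_zero G n)
  obtain ⟨m, hm, h⟩ := exists_apply_delta_eq G n
  have h1 : inner ℂ (gsVec G (n + 1)) (J.op (G.val (delta n)))
      = ‖gsRes G n‖ * inner ℂ (gsVec G (n + 1)) (J.op (gsVec G n)) := by
    rw [h, map_add, map_smul, inner_add_right, inner_smul_right,
      inner_gsVec_eq_zero G (op_mem_flagMap hc hm), add_zero]
  have h2 : J.op (delta n) - (J.a n : ℂ) • delta (n + 1) ∈ flag (n + 1) := by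
    have := flag_succ_decomp (op_mem_flag J (delta_mem_flag (lt_add_one n)))
    rwa [op_delta_apply, mat_succ] at this
  have h3 : J.op (G.val (delta n)) = (J.a n : ℂ) • G.val (delta (n + 1))
      + G.val (J.op (delta n) - (J.a n : ℂ) • delta (n + 1)) := by
    rw [map_sub, map_smul, add_sub_cancel]
    have := congrArg (fun T : Ell2 →L[ℂ] Ell2 => T (delta n)) hc.eq
    simpa using this.symm
  rw [h3, inner_add_right, inner_smul_right, inner_gsVec_apply_delta,
    inner_gsVec_eq_zero G ((apply_mem_flagMap G).2 h2), add_zero] at h1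
  rw [Complex.ofReal_mul, Complex.ofReal_div, ← mul_div_assoc, h1, mul_div_cancel_left₀ _ hpos]

lemma norm_inner_gsVec_op_le (j k : ℤ) : ‖inner ℂ (gsVec G j) (J.op (gsVec G k))‖ ≤ ‖J.op‖ := by
  refine (norm_inner_le_norm _ _).trans ?_
  rw [norm_gsVec, one_mul]
  simpa [norm_gsVec] using J.op.le_opNorm (gsVec G k)

/-- The matrix of a Jacobi operator that commutes with `G`, in the basis `gsVec G`. -/
def gsJacobi (hc : Commute G.val J.op) : Jacobi where
  a n := J.a n * (‖gsRes G (n + 1)‖ / ‖gsRes G n‖)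
  b n := (inner ℂ (gsVec G n) (J.op (gsVec G n)) : ℂ).re
  a_pos n := mul_pos (J.a_pos n) (div_pos (norm_pos_iff.2 (gsRes_ne_zero G _))
    (norm_pos_iff.2 (gsRes_ne_zero G _)))
  a_bdd := ⟨‖J.op‖, fun n => by
    rw [← Real.norm_eq_abs, ← Complex.norm_real, ← inner_gsVec_succ_op hc]
    exact norm_inner_gsVec_op_le G J _ _⟩
  b_bdd := ⟨‖J.op‖, fun n =>
    (Complex.abs_re_le_norm _).trans (norm_inner_gsVec_op_le G J _ _)⟩

lemma inner_gsVec_op_symm (j k : ℤ) : inner ℂ (gsVec G j) (J.op (gsVec G k))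
    = (starRingEnd ℂ) (inner ℂ (gsVec G k) (J.op (gsVec G j))) := by
  rw [inner_conj_symm, inner_op_left]

lemma gsJacobi_mat (hc : Commute G.val J.op) (j k : ℤ) :
    (gsJacobi G J hc).mat j k = inner ℂ (gsVec G j) (J.op (gsVec G k)) := by
  unfold Jacobi.mat
  split_ifs with h1 h2 h3
  · rw [inner_gsVec_op_symm, h1, inner_gsVec_succ_op hc, Complex.conj_ofReal]; rfl
  · rw [h2, inner_gsVec_succ_op hc]; rfl
  · subst h3
    exact Complex.conj_eq_iff_re.1 (inner_gsVec_op_symm G J j j).symm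
  · rcases lt_or_gt_of_ne h3 with h | h
    · rw [inner_gsVec_op_symm, inner_gsVec_op_eq_zero hc (by omega), map_zero]
    · rw [inner_gsVec_op_eq_zero hc (by omega)]

lemma gsJacobi_op (hc : Commute G.val J.op) :
    (gsJacobi G J hc).op = (gsUnitary G).symm.conjStarAlgEquiv J.op :=
  ext_entry fun j k => by
    rw [entry_op, gsJacobi_mat, entry, LinearIsometryEquiv.conjStarAlgEquiv_apply_apply,
      inner_gsUnitary_symm, gsUnitary_delta, LinearIsometryEquiv.symm_symm, gsUnitary_delta]

end Conj

/-! ### Gram-Schmidt vectors of a product -/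

section Mul

variable {G₁ G₂ G₃ : (Ell2 →L[ℂ] Ell2)ˣ}

lemma gsUnitary_mem_flagMap_mul
    (h : ∀ u, G₃.val u = (gsUnitary G₁).symm (G₂.val (gsUnitary G₁ u))) {n : ℤ} {u : Ell2} :
    gsUnitary G₁ u ∈ flagMap (G₂ * G₁) n ↔ u ∈ flagMap G₃ n := by
  have h1 : gsUnitary G₁ (G₃⁻¹.val u) = G₂⁻¹.val (gsUnitary G₁ u) := by
    rw [← inv_apply_self G₂ (gsUnitary G₁ (G₃⁻¹.val u))]
    congr 1
    rw [← (gsUnitary G₁).symm_apply_eq, ← h, apply_inv_self]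
  have h2 : gsUnitary G₁ u ∈ flagMap (G₂ * G₁) n ↔ gsUnitary G₁ (G₃⁻¹.val u) ∈ flagMap G₁ n := by
    rw [h1, mem_flagMap, mem_flagMap, mul_inv_rev]; rfl
  rw [h2, mem_flagMap (G := G₃)]
  exact ⟨fun H => by simpa using gsUnitary_symm_mem G₁ H, gsUnitary_mem G₁⟩

/-- With `Q = gsUnitary G₁`, the hypothesis reads `G₃ = Q⁻¹ G₂ Q`. Since `Q` carries `flag n` onto
`G₁ (flag n)`, it carries `G₃ (flag n)` onto `G₂ G₁ (flag n)`. The image of the Gram-Schmidt basis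
of `G₃` thus has the properties that characterize the one of `G₂ G₁`. -/
lemma gsVec_mul (h : ∀ u, G₃.val u = (gsUnitary G₁).symm (G₂.val (gsUnitary G₁ u))) (n : ℤ) :
    gsUnitary G₁ (gsVec G₃ n) = gsVec (G₂ * G₁) n := by
  have horth : ∀ u ∈ flagMap (G₂ * G₁) n, inner ℂ (gsUnitary G₁ (gsVec G₃ n)) u = 0 := by
    intro u hu
    rw [← (gsUnitary G₁).apply_symm_apply u] at hu ⊢
    rw [LinearIsometryEquiv.inner_map_map]
    exact inner_gsVec_eq_zero G₃ ((gsUnitary_mem_flagMap_mul h).1 hu)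
  refine eq_gsVec (G₂ * G₁) ((gsUnitary_mem_flagMap_mul h).2 (gsVec_mem G₃ n))
    ((Submodule.mem_orthogonal' _ _).2 horth)
    (by rw [LinearIsometryEquiv.norm_map, norm_gsVec]) (r := ‖gsRes G₁ n‖ * ‖gsRes G₃ n‖)
    (mul_pos (norm_pos_iff.2 (gsRes_ne_zero _ _)) (norm_pos_iff.2 (gsRes_ne_zero _ _))) ?_
  -- Positivity: up to `G₁ (flag n)`, whose image under `G₂` does not contribute, `G₁ δ_n` is
  -- `‖gsRes G₁ n‖` times `Q δ_n`. The remaining factor is the component of `G₃ δ_n` along `gsVec G₃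
  -- n`.
  obtain ⟨m, hm, hd⟩ := exists_apply_delta_eq G₁ n
  have hm' : G₂.val m ∈ flagMap (G₂ * G₁) n := by
    rw [mem_flagMap, mul_inv_rev]
    change G₁⁻¹.val (G₂⁻¹.val (G₂.val m)) ∈ _
    rw [inv_apply_self]
    exact hm
  have h4 : (G₂ * G₁).val (delta n) = G₂.val (G₁.val (delta n)) := rfl
  rw [h4, hd, map_add, map_smul, inner_add_right, horth _ hm', inner_smul_right, add_zero,
    ← gsUnitary_delta G₁ n, ← (gsUnitary G₁).apply_symm_apply (G₂.val _), ← h,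
    LinearIsometryEquiv.inner_map_map, inner_gsVec_apply_delta, Complex.ofReal_mul]

lemma gsVec_one (n : ℤ) : gsVec 1 n = delta n := by
  have h : ∀ k, flagMap 1 k = flag k := fun k => rfl
  refine (eq_gsVec 1 (by rw [h]; exact delta_mem_flag (by omega)) ?_ (norm_delta n) one_pos ?_).symm
  · refine (Submodule.mem_orthogonal' _ _).2 fun u hu => ?_
    rw [inner_delta_left]
    exact hu n le_rfl
  · rw [inner_delta_left]
    simp [delta_apply]

end Mul

/-! ### Exponentials and functional calculus under unitary conjugation -/

section FunCalc

variable {H : Type*} [NormedAddCommGroup H] [InnerProductSpace ℂ H] [CompleteSpace H]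

/-- The exponential of a bounded operator, as an invertible operator. -/
def expUnit (F : H →L[ℂ] H) : (H →L[ℂ] H)ˣ where
  val := NormedSpace.exp F
  inv := NormedSpace.exp (-F)
  val_inv := by
    let +nondep : NormedAlgebra ℚ (H →L[ℂ] H) := .restrictScalars ℚ ℂ _
    rw [← NormedSpace.exp_add_of_commute ((Commute.refl F).neg_right), add_neg_cancel,
      NormedSpace.exp_zero]
  inv_val := by
    let +nondep : NormedAlgebra ℚ (H →L[ℂ] H) := .restrictScalars ℚ ℂ _
    rw [← NormedSpace.exp_add_of_commute ((Commute.refl F).neg_left), neg_add_cancel,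
      NormedSpace.exp_zero]

lemma expUnit_zero : expUnit (0 : H →L[ℂ] H) = 1 := Units.ext NormedSpace.exp_zero

lemma expUnit_add {F F' : H →L[ℂ] H} (h : Commute F F') :
    expUnit (F + F') = expUnit F * expUnit F' := by
  let +nondep : NormedAlgebra ℚ (H →L[ℂ] H) := .restrictScalars ℚ ℂ _
  exact Units.ext (NormedSpace.exp_add_of_commute h)

lemma commute_funCalc_funCalc (f g : ℝ → ℝ) (X : H →L[ℂ] H) :
    Commute (funCalc f X) (funCalc g X) := cfc_commute_cfc f g X

lemma commute_funCalc (f : ℝ → ℝ) {X : H →L[ℂ] H} (hX : IsSelfAdjoint X) :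
    Commute (funCalc f X) X := by
  have := cfc_commute_cfc f id X
  rwa [cfc_id ℝ X hX] at this

lemma isSelfAdjoint_funCalc (f : ℝ → ℝ) (X : H →L[ℂ] H) : IsSelfAdjoint (funCalc f X) :=
  cfc_predicate f X

lemma funCalc_zero (X : H →L[ℂ] H) : funCalc 0 X = 0 := cfc_zero ℝ X

lemma funCalc_add {f g : ℝ → ℝ} (hf : Continuous f) (hg : Continuous g) (X : H →L[ℂ] H) :
    funCalc (f + g) X = funCalc f X + funCalc g X :=
  cfc_add X f g hf.continuousOn hg.continuousOn

lemma funCalc_smul {f : ℝ → ℝ} (hf : Continuous f) (t : ℝ) (X : H →L[ℂ] H) :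
    funCalc (t • f) X = (t : ℂ) • funCalc f X := by
  rw [Complex.coe_smul]
  exact cfc_smul t f X hf.continuousOn

lemma norm_funCalc_le {f : ℝ → ℝ} {X : H →L[ℂ] H} {c : ℝ} (hc : 0 ≤ c)
    (h : ∀ x : ℝ, |x| ≤ ‖X‖ → |f x| ≤ c) : ‖funCalc f X‖ ≤ c := by
  rcases subsingleton_or_nontrivial (H →L[ℂ] H) with h' | h'
  · rw [Subsingleton.elim (funCalc f X) 0, norm_zero]; exact hc
  · exact norm_cfc_le hc fun x hx => h x (spectrum.norm_le_norm_of_mem hx)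

lemma continuous_conj (U : H ≃ₗᵢ[ℂ] H) : Continuous U.conjStarAlgEquiv := by
  have : (U.conjStarAlgEquiv : (H →L[ℂ] H) → (H →L[ℂ] H)) = fun X =>
    ((U : H ≃L[ℂ] H) : H →L[ℂ] H) ∘L X ∘L ((U.symm : H ≃L[ℂ] H) : H →L[ℂ] H) := rfl
  rw [this]
  fun_prop

lemma funCalc_conj (U : H ≃ₗᵢ[ℂ] H) {g : ℝ → ℝ} (hg : Continuous g) {X : H →L[ℂ] H}
    (hX : IsSelfAdjoint X) :
    funCalc g (U.conjStarAlgEquiv X) = U.conjStarAlgEquiv (funCalc g X) :=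
  (StarAlgHomClass.map_cfc (S := ℂ) U.conjStarAlgEquiv g X hg.continuousOn
    (continuous_conj U) hX (hX.map _)).symm

lemma norm_conj (U : H ≃ₗᵢ[ℂ] H) (X : H →L[ℂ] H) : ‖U.conjStarAlgEquiv X‖ = ‖X‖ :=
  StarAlgEquiv.norm_map U.conjStarAlgEquiv X

lemma expUnit_conj (U : H ≃ₗᵢ[ℂ] H) (F : H →L[ℂ] H) :
    (expUnit (U.conjStarAlgEquiv F)).val = U.conjStarAlgEquiv (expUnit F).val := by
  let +nondep : NormedAlgebra ℚ (H →L[ℂ] H) := .restrictScalars ℚ ℂ _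
  exact (NormedSpace.map_exp U.conjStarAlgEquiv (continuous_conj U) F).symm

end FunCalc

/-! ### The factorization flow and its group law -/

lemma commute_expUnit (f : ℝ → ℝ) (J : Jacobi) : Commute (expUnit (funCalc f J.op)).val J.op :=
  (commute_funCalc f (isSelfAdjoint_op J)).exp_left

/-- The time-one map of the generalized Toda flow, by Gram-Schmidt factorization of `exp f(J)`. -/
def qrFlow (f : ℝ → ℝ) (J : Jacobi) : Jacobi := gsJacobi _ J (commute_expUnit f J)

/-- The unitary operator that conjugates `J` to `qrFlow f J`. -/
def qrUnitary (f : ℝ → ℝ) (J : Jacobi) : Ell2 ≃ₗᵢ[ℂ] Ell2 := gsUnitary (expUnit (funCalc f J.op))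

lemma qrFlow_op (f : ℝ → ℝ) (J : Jacobi) :
    (qrFlow f J).op = (qrUnitary f J).symm.conjStarAlgEquiv J.op := gsJacobi_op _ _ _

lemma norm_qrFlow_op (f : ℝ → ℝ) (J : Jacobi) : ‖(qrFlow f J).op‖ = ‖J.op‖ := by
  rw [qrFlow_op, norm_conj]

lemma qrFlow_mat (f : ℝ → ℝ) (J : Jacobi) (j k : ℤ) : (qrFlow f J).mat j k =
    inner ℂ (gsVec (expUnit (funCalc f J.op)) j) (J.op (gsVec (expUnit (funCalc f J.op)) k)) :=
  gsJacobi_mat _ _ _ _ _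

lemma inner_qrFlow_op (f : ℝ → ℝ) (J : Jacobi) (u v : Ell2) :
    inner ℂ u ((qrFlow f J).op v) = inner ℂ (qrUnitary f J u) (J.op (qrUnitary f J v)) := by
  rw [qrFlow_op, LinearIsometryEquiv.conjStarAlgEquiv_apply_apply, LinearIsometryEquiv.symm_symm]
  exact inner_gsUnitary_symm _ _ _

theorem qrFlow_qrFlow {f g : ℝ → ℝ} (hf : Continuous f) (hg : Continuous g) (J : Jacobi) :
    qrFlow f (qrFlow g J) = qrFlow (f + g) J := by
  set G₁ := expUnit (funCalc g J.op)
  set G₂ := expUnit (funCalc f J.op)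
  set G₃ := expUnit (funCalc f (qrFlow g J).op)
  have h12 : G₂ * G₁ = expUnit (funCalc (f + g) J.op) := by
    rw [funCalc_add hf hg, expUnit_add (commute_funCalc_funCalc f g J.op)]
  -- The functional calculus and the exponential commute with unitary conjugation, so `exp f` at the
  -- conjugated Jacobi matrix is the conjugate of `exp f(J)`.
  have h3 : ∀ u, G₃.val u = (gsUnitary G₁).symm (G₂.val (gsUnitary G₁ u)) := by
    intro u
    have : G₃.val = (gsUnitary G₁).symm.conjStarAlgEquiv G₂.val := by
      rw [← expUnit_conj, ← funCalc_conj _ hf (isSelfAdjoint_op J)]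
      change (expUnit (funCalc f (qrFlow g J).op)).val = _
      rw [qrFlow_op]; rfl
    rw [this]; rfl
  have h4 : ∀ n, qrUnitary g J (gsVec G₃ n) = gsVec (expUnit (funCalc (f + g) J.op)) n :=
    fun n => by rw [← h12]; exact gsVec_mul h3 n
  refine op_injective (ext_entry fun j k => ?_)
  rw [entry_op, entry_op, qrFlow_mat, inner_qrFlow_op, h4, h4, qrFlow_mat]

lemma qrFlow_zero (J : Jacobi) : qrFlow 0 J = J := by
  have h : expUnit (funCalc 0 J.op) = 1 := by rw [funCalc_zero, expUnit_zero]
  refine op_injective (ext_entry fun j k => ?_)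
  rw [entry_op, qrFlow_mat, h, gsVec_one, gsVec_one]; rfl

/-! ### First-order expansion of the Gram-Schmidt vectors -/

section Hilbert

variable {H : Type*} [NormedAddCommGroup H] [InnerProductSpace ℂ H]

/-- By the functional calculus this reduces to the scalar bound `|eˣ - 1 - x| ≤ x²` for `|x| ≤ 1`.
-/
lemma norm_exp_sub_one_sub_self_le [CompleteSpace H] {F : H →L[ℂ] H} (hF : IsSelfAdjoint F) (h1 : ‖F‖ ≤ 1) :
    ‖NormedSpace.exp F - 1 - F‖ ≤ ‖F‖ ^ 2 := by
  have h : NormedSpace.exp F - 1 - F = funCalc (fun x : ℝ => Real.exp x - 1 - x) F := by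
    unfold funCalc
    rw [cfc_sub (fun x : ℝ => Real.exp x - 1) (fun x => x) F, cfc_sub (fun x : ℝ => Real.exp x)
      (fun _ => 1) F, cfc_id' ℝ F hF, cfc_const_one ℝ F, CFC.real_exp_eq_normedSpace_exp]
  rw [h]
  refine norm_funCalc_le (by positivity) fun x hx => ?_
  refine (Real.abs_exp_sub_one_sub_id_le (hx.trans h1)).trans ?_
  rw [← sq_abs]
  gcongr

lemma norm_exp_mul_exp_sub_le [CompleteSpace H] {F : H →L[ℂ] H} (hF : IsSelfAdjoint F)
    (h1 : ‖F‖ ≤ 1 / 16) :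
    ‖NormedSpace.exp F * NormedSpace.exp F - 1 - (F + F)‖ ≤ 4 * ‖F‖ ^ 2 := by
  have h2 : ‖F + F‖ ≤ 2 * ‖F‖ := (norm_add_le _ _).trans (by linarith)
  have h3 : NormedSpace.exp F * NormedSpace.exp F = NormedSpace.exp (F + F) :=
    congrArg Units.val (expUnit_add (Commute.refl F)).symm
  rw [h3]
  refine (norm_exp_sub_one_sub_self_le (hF.add hF) (by linarith)).trans ?_
  nlinarith [norm_nonneg (F + F)]

lemma norm_le_two_mul_norm_exp_apply [CompleteSpace H] {F : H →L[ℂ] H} (hF : IsSelfAdjoint F)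
    (h1 : ‖F‖ ≤ 1 / 16) (z : H) : ‖z‖ ≤ 2 * ‖NormedSpace.exp F z‖ := by
  have h2 : ‖NormedSpace.exp (-F) - 1 - (-F)‖ ≤ ‖F‖ ^ 2 := by
    have := norm_exp_sub_one_sub_self_le hF.neg (by rw [norm_neg]; linarith)
    rwa [norm_neg] at this
  set v := NormedSpace.exp F z
  have h3 : NormedSpace.exp (-F) v = z :=
    congrArg (fun T : H →L[ℂ] H => T z) (expUnit F).inv_mul
  have h4 : z = v + (-F) v + (NormedSpace.exp (-F) - 1 - (-F)) v := by
    conv_lhs => rw [← h3]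
    simp only [sub_apply, neg_apply, one_apply_eq_self]
    abel
  rw [h4]
  refine (norm_add_le _ _).trans ((add_le_add_left (norm_add_le _ _) _).trans ?_)
  have h5 : ‖(-F) v‖ ≤ ‖F‖ * ‖v‖ := by simpa using (-F).le_opNorm v
  have h6 := ((NormedSpace.exp (-F) - 1 - (-F)).le_opNorm v).trans
    (mul_le_mul_of_nonneg_right h2 (norm_nonneg v))
  have h7 : ‖F‖ ^ 2 ≤ 1 / 16 := by nlinarith [norm_nonneg F]
  nlinarith [norm_nonneg v]

/-- First-order expansion of the normalization of a vector near the unit vector `e`. -/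
lemma norm_normalize_sub_le {e u r : H} {ε c : ℝ} (he : ‖e‖ = 1) (hε : ε ≤ 1 / 16)
    (hu : ‖u‖ ≤ 3 * ε) (hr : ‖r - (e + u)‖ ≤ 29 * ε ^ 2) (hc : inner ℂ e u = (c : ℂ))
    (hcε : |c| ≤ ε) :
    ‖((‖r‖⁻¹ : ℝ) : ℂ) • r - (e + u - (c : ℂ) • e)‖ ≤ 222 * ε ^ 2 := by
  have hε0 : 0 ≤ ε := (abs_nonneg c).trans hcε
  obtain ⟨hc1, hc2⟩ := abs_le.1 hcε
  set s := ‖e + u‖ with hs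
  have hs2 : s ^ 2 = 1 + 2 * c + ‖u‖ ^ 2 := by
    rw [hs, @norm_add_sq ℂ, he, hc]; simp
  have hs0 : 0 ≤ s := norm_nonneg _
  have hu0 := norm_nonneg u
  have hu2 : ‖u‖ ^ 2 ≤ 9 * ε ^ 2 := by nlinarith
  -- From `s² - (1 + c)² = ‖u‖² - c²`, divided by `s + (1 + c)`, which is close to `2`.
  have hs3 : |s - (1 + c)| ≤ 10 * ε ^ 2 := by
    rw [abs_le]
    constructor
    · by_contra! h
      nlinarith [sq_nonneg ε]
    · by_contra! h
      nlinarith [sq_nonneg ε]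
  have hρ1 : |‖r‖ - s| ≤ 29 * ε ^ 2 := (abs_norm_sub_norm_le _ _).trans hr
  set ρ := ‖r‖ with hρ
  have hρ2 : |ρ - (1 + c)| ≤ 39 * ε ^ 2 := by
    have := abs_sub_le ρ s (1 + c)
    linarith
  have hρ3 : 1 / 2 ≤ ρ := by
    have := (abs_le.1 hρ2).1
    nlinarith
  set y := e + u - (c : ℂ) • e with hy
  have hy1 : ‖y‖ ≤ 2 := by
    refine (norm_sub_le _ _).trans ((add_le_add_left (norm_add_le _ _) _).trans ?_)
    rw [norm_smul, he, Complex.norm_real, Real.norm_eq_abs]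
    linarith
  -- The terms have norm at most `29 ε²`, `3 ε²`, `ε²` and `78 ε²`, in total `111 ε²`. The final
  -- division by `ρ ≥ 1/2` doubles this.
  have key : r - (ρ : ℂ) • y = (r - (e + u)) - (c : ℂ) • u + ((c ^ 2 : ℝ) : ℂ) • e
      - ((ρ - (1 + c) : ℝ) : ℂ) • y := by
    rw [hy]
    push_cast
    module
  have hkey : ‖r - (ρ : ℂ) • y‖ ≤ 111 * ε ^ 2 := by
    rw [key]
    refine (norm_sub_le _ _).trans ((add_le_add_left ((norm_add_le _ _).trans
      (add_le_add_left (norm_sub_le _ _) _)) _).trans ?_)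
    rw [norm_smul, norm_smul, norm_smul, Complex.norm_real, Complex.norm_real, Complex.norm_real,
      Real.norm_eq_abs, Real.norm_eq_abs, Real.norm_eq_abs, he, abs_of_nonneg (sq_nonneg c)]
    have h1 : |c| * ‖u‖ ≤ ε * (3 * ε) := by gcongr
    have h2 : |ρ - (1 + c)| * ‖y‖ ≤ 39 * ε ^ 2 * 2 := by gcongr
    have h3 : c ^ 2 ≤ ε ^ 2 := sq_le_sq' hc1 hc2
    linarith
  have hfin : ((ρ⁻¹ : ℝ) : ℂ) • r - y = ((ρ⁻¹ : ℝ) : ℂ) • (r - (ρ : ℂ) • y) := by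
    rw [smul_sub, smul_smul, ← Complex.ofReal_mul, inv_mul_cancel₀ (by linarith),
      Complex.ofReal_one, one_smul]
  rw [hfin, norm_smul, Complex.norm_real, Real.norm_of_nonneg (by positivity)]
  have : ρ⁻¹ ≤ 2 := by
    rw [inv_le_comm₀ (by linarith) two_pos]; linarith
  calc ρ⁻¹ * ‖r - (ρ : ℂ) • y‖ ≤ 2 * (111 * ε ^ 2) := by gcongr
    _ = 222 * ε ^ 2 := by ring

end Hilbert

instance (n : ℤ) : CompleteSpace (flag n) := (isClosed_flag n).completeSpace_coe

lemma starProjection_flag_apply (n : ℤ) (u : Ell2) (j : ℤ) :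
    (flag n).starProjection u j = if j < n then u j else 0 := by
  split_ifs with h
  · have := (Submodule.mem_orthogonal _ _).1
      ((flag n).sub_starProjection_mem_orthogonal u) _ (delta_mem_flag h)
    rw [inner_sub_right, inner_delta_left, inner_delta_left, sub_eq_zero] at this
    exact this.symm
  · exact (flag n).starProjection_apply_mem u j (not_lt.1 h)

/-- The first-order part of the Gram-Schmidt vector `gsVec (expUnit F) n`. -/
def gsVecDeriv (F : Ell2 →L[ℂ] Ell2) (n : ℤ) : Ell2 :=
  F (delta n) - (2 : ℂ) • (flag n).starProjection (F (delta n)) - F (delta n) n • delta n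

/-- Below the diagonal the entry of `F` survives, on the diagonal it cancels, and above the diagonal
subtracting twice the projection reverses its sign. -/
lemma gsVecDeriv_apply (F : Ell2 →L[ℂ] Ell2) (n j : ℤ) :
    gsVecDeriv F n j = -antisymm F j n := by
  have h : gsVecDeriv F n j = F (delta n) j - 2 * (flag n).starProjection (F (delta n)) j
      - F (delta n) n * delta n j := rfl
  rw [h, starProjection_flag_apply, delta_apply]
  simp only [antisymm, entry, inner_delta_left]
  split_ifs <;> first | omega | (subst_vars; ring)

lemma norm_apply_delta_le (F : Ell2 →L[ℂ] Ell2) (n : ℤ) : ‖F (delta n)‖ ≤ ‖F‖ := by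
  simpa [norm_delta] using F.le_opNorm (delta n)

lemma norm_gsVecDeriv_le (F : Ell2 →L[ℂ] Ell2) (n : ℤ) : ‖gsVecDeriv F n‖ ≤ 4 * ‖F‖ := by
  have h1 := norm_apply_delta_le F n
  have h2 : ‖(flag n).starProjection (F (delta n))‖ ≤ ‖F‖ :=
    ((flag n).norm_starProjection_apply_le _).trans h1
  have h3 : ‖F (delta n) n‖ ≤ ‖F‖ := by
    rw [← inner_delta_left]; exact norm_entry_le F n n
  unfold gsVecDeriv
  refine (norm_sub_le _ _).trans ((add_le_add_left (norm_sub_le _ _) _).trans ?_)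
  rw [norm_smul, norm_smul, norm_delta, Complex.norm_ofNat]
  linarith

lemma inner_isSelfAdjoint {F : Ell2 →L[ℂ] Ell2} (hF : IsSelfAdjoint F) (u v : Ell2) :
    inner ℂ (F u) v = inner ℂ u (F v) := by
  conv_lhs => rw [← hF.star_eq]
  rw [ContinuousLinearMap.star_eq_adjoint, ContinuousLinearMap.adjoint_inner_left]

/-- The projection of `exp(F) δ_n` to `exp(F) (flag n)`, to first order in `F`. -/
lemma norm_starProjection_flagMap_sub_le {F : Ell2 →L[ℂ] Ell2} (hF : IsSelfAdjoint F)
    (hF1 : ‖F‖ ≤ 1 / 16) (n : ℤ) :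
    ‖(flagMap (expUnit F) n).starProjection ((expUnit F).val (delta n))
      - (2 : ℂ) • (flag n).starProjection (F (delta n))‖ ≤ 28 * ‖F‖ ^ 2 := by
  set ε := ‖F‖ with hε
  have hε0 : 0 ≤ ε := norm_nonneg _
  set G := expUnit F with hG
  set p := (2 : ℂ) • (flag n).starProjection (F (delta n)) with hp
  have hpm : p ∈ flag n := Submodule.smul_mem _ _ (Submodule.starProjection_apply_mem _ _)
  have hpn : ‖p‖ ≤ 2 * ε := by
    rw [hp, norm_smul, Complex.norm_ofNat]
    gcongr
    exact ((flag n).norm_starProjection_apply_le _).trans (norm_apply_delta_le F n)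
  have hGval : G.val = NormedSpace.exp F := rfl
  have hGsa : IsSelfAdjoint G.val := by
    rw [hGval]; exact hF.exp
  set E₂ := NormedSpace.exp F * NormedSpace.exp F - 1 - (F + F) with hE₂
  have hE₂n : ‖E₂‖ ≤ 4 * ε ^ 2 := norm_exp_mul_exp_sub_le hF hF1
  have hGG : ∀ u, G.val (G.val u) = u + (2 : ℂ) • F u + E₂ u := by
    intro u
    have h2 : NormedSpace.exp F * NormedSpace.exp F = 1 + (F + F) + E₂ := by rw [hE₂]; abel
    rw [two_smul]
    exact congrArg (fun T : Ell2 →L[ℂ] Ell2 => T u) h2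
  have hinv : ∀ z, ‖z‖ ≤ 2 * ‖G.val z‖ := norm_le_two_mul_norm_exp_apply hF hF1
  set m := (flagMap G n).starProjection (G.val (delta n)) with hm
  have hGp : G.val p ∈ flagMap G n := (apply_mem_flagMap G).2 hpm
  -- `G p` is an approximate solution of the least squares problem. The exact one, `m = G y` with `y
  -- ∈ flag n`, makes `G² (δ_n - y)` orthogonal to `flag n`. As `G² = exp(2F)` is `1 + 2F` to first
  -- order, `y` is close to the projection of `2F δ_n`, which is `p`.
  set d := m - G.val p with hd
  have hdm : d ∈ flagMap G n := sub_mem (Submodule.starProjection_apply_mem _ _) hGp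
  set z := G⁻¹.val d with hz
  have hGz : G.val z = d := apply_inv_self G d
  have hzm : z ∈ flag n := hdm
  have hdd : ‖d‖ ^ 2 ≤ ‖z‖ * (12 * ε ^ 2) := by
    have h1 : inner ℂ d d = inner ℂ z (E₂ (delta n - p) - (2 : ℂ) • F p) := by
      have h2 : inner ℂ d (G.val (delta n) - m) = 0 :=
        (Submodule.mem_orthogonal _ _).1 (gsRes_mem_orthogonal G n) _ hdm
      have h3 : inner ℂ d d = inner ℂ d (G.val (delta n - p)) := by
        rw [← add_zero (inner ℂ d d), ← h2, ← inner_add_right, hd, map_sub]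
        congr 1; abel
      have h4 : inner ℂ z (delta n) = 0 := by
        rw [inner_delta_right, hzm n le_rfl, map_zero]
      have h5 : inner ℂ z ((2 : ℂ) • F (delta n) - p) = 0 := by
        rw [hp, ← smul_sub, inner_smul_right, (Submodule.mem_orthogonal _ _).1
          ((flag n).sub_starProjection_mem_orthogonal (F (delta n))) _ hzm, mul_zero]
      rw [h3]
      nth_rewrite 1 [← hGz]
      rw [inner_isSelfAdjoint hGsa, hGG, ← add_zero (inner ℂ z (_ - _)), ← h5, ← add_zero
        (inner ℂ z (_ - _) + _), ← h4, ← inner_add_right, ← inner_add_right]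
      congr 1
      rw [map_sub, smul_sub]; abel
    have h6 : ‖E₂ (delta n - p) - (2 : ℂ) • F p‖ ≤ 12 * ε ^ 2 := by
      refine (norm_sub_le _ _).trans ?_
      have h7 : ‖E₂ (delta n - p)‖ ≤ 4 * ε ^ 2 * (1 + 2 * ε) := by
        refine (E₂.le_opNorm _).trans ?_
        gcongr
        refine (norm_sub_le _ _).trans ?_
        rw [norm_delta]; linarith
      have h8 : ‖(2 : ℂ) • F p‖ ≤ 2 * (ε * (2 * ε)) := by
        rw [norm_smul, Complex.norm_ofNat]
        gcongr
        exact (F.le_opNorm p).trans (by gcongr)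
      nlinarith [sq_nonneg ε]
    have h9 : ‖d‖ ^ 2 = ‖inner ℂ d d‖ := by
      rw [inner_self_eq_norm_sq_to_K, norm_pow]; simp
    rw [h9, h1]
    exact (norm_inner_le_norm _ _).trans (by gcongr)
  -- `hdd` together with `‖z‖ ≤ 2 ‖d‖`.
  have hdn : ‖d‖ ≤ 24 * ε ^ 2 := by
    have h1 := hinv z
    rw [hGz] at h1
    by_contra! h
    have h2 : 0 < ‖d‖ := lt_of_le_of_lt (by positivity) h
    nlinarith [sq_nonneg ε]
  have hGpp : ‖G.val p - p‖ ≤ 4 * ε ^ 2 := by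
    have h1 := norm_exp_sub_one_sub_self_le hF (by linarith)
    have h2 : G.val p - p = F p + (NormedSpace.exp F - 1 - F) p := by
      rw [hGval]; simp
    rw [h2]
    have h3 := (F.le_opNorm p).trans (mul_le_mul_of_nonneg_left hpn hε0)
    have h4 := ((NormedSpace.exp F - 1 - F).le_opNorm p).trans
      (mul_le_mul h1 hpn (norm_nonneg _) (by positivity))
    refine (norm_add_le _ _).trans ?_
    nlinarith [sq_nonneg ε]
  have h : m - p = d + (G.val p - p) := by rw [hd]; abel
  rw [h]
  exact (norm_add_le _ _).trans (by linarith)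

/-- The residual is `δ_n + F δ_n - p` up to `28 ‖F‖²` from the projection and `‖F‖²` from the
exponential. Normalizing it removes, to first order, the component of `F δ_n` along `δ_n`, which is
real. -/
lemma norm_gsVec_sub_le {F : Ell2 →L[ℂ] Ell2} (hF : IsSelfAdjoint F) (hF1 : ‖F‖ ≤ 1 / 16) (n : ℤ) :
    ‖gsVec (expUnit F) n - (delta n + gsVecDeriv F n)‖ ≤ 222 * ‖F‖ ^ 2 := by
  set p := (2 : ℂ) • (flag n).starProjection (F (delta n)) with hp
  have hu : ‖F (delta n) - p‖ ≤ 3 * ‖F‖ := by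
    refine (norm_sub_le _ _).trans ?_
    have h1 := norm_apply_delta_le F n
    have h2 := ((flag n).norm_starProjection_apply_le (F (delta n))).trans h1
    rw [hp, norm_smul, Complex.norm_ofNat]
    linarith
  have hr : ‖gsRes (expUnit F) n - (delta n + (F (delta n) - p))‖ ≤ 29 * ‖F‖ ^ 2 := by
    have h1 := norm_starProjection_flagMap_sub_le hF hF1 n
    have h2 := ((NormedSpace.exp F - 1 - F).le_opNorm (delta n)).trans
      (mul_le_mul_of_nonneg_right (norm_exp_sub_one_sub_self_le hF (by linarith)) (norm_nonneg _))
    rw [norm_delta, mul_one] at h2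
    have h3 : gsRes (expUnit F) n - (delta n + (F (delta n) - p))
        = (NormedSpace.exp F - 1 - F) (delta n)
          - ((flagMap (expUnit F) n).starProjection ((expUnit F).val (delta n)) - p) := by
      have : (expUnit F).val (delta n) = delta n + F (delta n)
          + (NormedSpace.exp F - 1 - F) (delta n) := by
        change NormedSpace.exp F (delta n) = _
        simp
      rw [gsRes]
      nth_rewrite 1 [this]
      abel
    rw [h3]
    exact (norm_sub_le _ _).trans (by linarith)
  have hreal : ((F (delta n) n).re : ℂ) = F (delta n) n := by
    rw [← inner_delta_left]
    refine Complex.conj_eq_iff_re.1 ?_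
    rw [inner_conj_symm, inner_isSelfAdjoint hF]
  have hc : inner ℂ (delta n) (F (delta n) - p) = ((F (delta n) n).re : ℂ) := by
    have : p n = 0 := Submodule.smul_mem _ (2 : ℂ)
      ((flag n).starProjection_apply_mem (F (delta n))) n le_rfl
    rw [inner_sub_right, inner_delta_left, inner_delta_left, this, sub_zero, hreal]
  have hcn : |(F (delta n) n).re| ≤ ‖F‖ := by
    refine (Complex.abs_re_le_norm _).trans ?_
    rw [← inner_delta_left]
    exact norm_entry_le F n n
  have := norm_normalize_sub_le (norm_delta n) hF1 hu hr hc hcn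
  rw [hreal] at this
  have h : delta n + gsVecDeriv F n = delta n + (F (delta n) - p) - F (delta n) n • delta n := by
    rw [gsVecDeriv]; abel
  rw [h]
  exact this

/-! ### Comparison of the flow with the Lax field -/

lemma sum_Icc_three (f : ℤ → ℂ) (n : ℤ) :
    ∑ l ∈ Finset.Icc (n - 1) (n + 1), f l = f (n + 1) + f (n - 1) + f n := by
  have : Finset.Icc (n - 1) (n + 1) = {n + 1, n - 1, n} := by
    ext l
    simp only [Finset.mem_Icc, Finset.mem_insert, Finset.mem_singleton]
    omega
  rw [this, Finset.sum_insert, Finset.sum_pair (by omega), add_assoc]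
  simp only [Finset.mem_insert, Finset.mem_singleton]
  omega

lemma op_apply_eq_sum (J : Jacobi) (u : Ell2) (n : ℤ) :
    J.op u n = ∑ l ∈ Finset.Icc (n - 1) (n + 1), J.mat n l * u l := by
  rw [sum_Icc_three, Jacobi.op, tridiagOp_apply]

lemma conj_antisymm {F : Ell2 →L[ℂ] Ell2} (hF : IsSelfAdjoint F) (j k : ℤ) :
    (starRingEnd ℂ) (antisymm F j k) = -antisymm F k j := by
  have h : (starRingEnd ℂ) (entry F j k) = entry F k j := by rw [← entry_star, hF.star_eq]
  unfold antisymm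
  split_ifs <;> first | omega | simp [h]

/-- The commutator with the antisymmetric part, through the first-order Gram-Schmidt vectors. -/
lemma commEntry_antisymm {F : Ell2 →L[ℂ] Ell2} (hF : IsSelfAdjoint F) (J : Jacobi) (j k : ℤ) :
    commEntry (antisymm F) J j k
      = inner ℂ (gsVecDeriv F j) (J.op (delta k)) + inner ℂ (delta j) (J.op (gsVecDeriv F k)) := by
  rw [commEntry, sub_eq_add_neg]
  congr 1
  · rw [← inner_op_left, inner_delta_right, op_apply_eq_sum, map_sum]
    refine Finset.sum_congr rfl fun l _ => ?_
    rw [map_mul, gsVecDeriv_apply, map_neg, conj_antisymm hF, conj_mat, mat_symm J k l]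
    ring
  · rw [inner_delta_left, op_apply_eq_sum, ← Finset.sum_neg_distrib]
    refine Finset.sum_congr rfl fun l _ => ?_
    rw [gsVecDeriv_apply]
    ring

lemma norm_inner_op_le (T : Ell2 →L[ℂ] Ell2) {u v : Ell2} {A B : ℝ} (hu : ‖u‖ ≤ A) (hv : ‖v‖ ≤ B) :
    ‖inner ℂ u (T v)‖ ≤ ‖T‖ * (A * B) := by
  have hA : 0 ≤ A := (norm_nonneg _).trans hu
  calc ‖inner ℂ u (T v)‖ ≤ ‖u‖ * ‖T v‖ := norm_inner_le_norm _ _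
    _ ≤ A * (‖T‖ * B) := by
      gcongr
      exact (T.le_opNorm v).trans (by gcongr)
    _ = ‖T‖ * (A * B) := by ring

lemma norm_inner_gsVec_op_sub_le {F : Ell2 →L[ℂ] Ell2} (hF : IsSelfAdjoint F)
    (hF1 : ‖F‖ ≤ 1 / 16) (J : Jacobi) (j k : ℤ) :
    ‖inner ℂ (gsVec (expUnit F) j) (J.op (gsVec (expUnit F) k)) - J.mat j k
      - commEntry (antisymm F) J j k‖ ≤ 700 * ‖J.op‖ * ‖F‖ ^ 2 := by
  set q := gsVec (expUnit F)
  set w := gsVecDeriv F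
  have hF0 := norm_nonneg F
  have he : ∀ n, ‖q n - (delta n + w n)‖ ≤ 222 * ‖F‖ ^ 2 := norm_gsVec_sub_le hF hF1
  have hw : ∀ n, ‖w n‖ ≤ 4 * ‖F‖ := norm_gsVecDeriv_le F
  have hd : ∀ n, ‖delta n + w n‖ ≤ 2 := fun n => by
    refine (norm_add_le _ _).trans ?_
    rw [norm_delta]
    linarith [hw n]
  have h : inner ℂ (q j) (J.op (q k)) - J.mat j k - commEntry (antisymm F) J j k
      = inner ℂ (w j) (J.op (w k)) + inner ℂ (q j - (delta j + w j)) (J.op (q k))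
        + inner ℂ (delta j + w j) (J.op (q k - (delta k + w k))) := by
    rw [commEntry_antisymm hF, ← entry_op, entry]
    simp only [map_add, map_sub, inner_add_left, inner_add_right, inner_sub_left, inner_sub_right]
    ring
  rw [h]
  refine (norm_add_le _ _).trans ((add_le_add_left (norm_add_le _ _) _).trans ?_)
  -- The three terms contribute `16`, `222` and `2 · 222` times `‖J‖ ‖F‖²`, in total less than
  -- `700`.
  have h1 := norm_inner_op_le J.op (hw j) (hw k)
  have h2 := norm_inner_op_le J.op (he j) (norm_gsVec (expUnit F) k).le
  have h3 := norm_inner_op_le J.op (hd j) (he k)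
  have h4 : 0 ≤ ‖J.op‖ * ‖F‖ ^ 2 := by positivity
  linarith

lemma norm_weightedShift_le {c : ℤ → ℂ} (hc : ∃ C, ∀ n, ‖c n‖ ≤ C) (d : ℤ) {C : ℝ}
    (hC : ∀ n, ‖c n‖ ≤ C) : ‖weightedShift c hc d‖ ≤ C := by
  have hC0 : 0 ≤ C := (norm_nonneg _).trans (hC 0)
  refine ContinuousLinearMap.opNorm_le_bound _ hC0 fun u => ?_
  refine (sq_le_sq₀ (norm_nonneg _) (by positivity)).1 ?_
  rw [norm_sq_eq, mul_pow, norm_sq_eq, ← (Equiv.addRight d).tsum_eq (fun n : ℤ => ‖u n‖ ^ 2),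
    ← tsum_mul_left]
  exact Summable.tsum_le_tsum (fun n => weightedShift_bound hC d u n)
    (weightedShift_summable hC d u) ((summable_sq_shift d u).mul_left _)

lemma norm_tridiagOp_le {M : ℤ → ℤ → ℂ} (hM : ∃ C, ∀ j k, ‖M j k‖ ≤ C) {C : ℝ}
    (hC : ∀ j k, |j - k| ≤ 1 → ‖M j k‖ ≤ C) : ‖tridiagOp M hM‖ ≤ 3 * C := by
  have h : ∀ n d : ℤ, |d| ≤ 1 → ‖M n (n + d)‖ ≤ C := fun n d hd =>
    hC _ _ (by rwa [sub_add_cancel_left, abs_neg])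
  unfold tridiagOp
  refine (norm_add_le _ _).trans ((add_le_add_left (norm_add_le _ _) _).trans ?_)
  have h1 := norm_weightedShift_le (hM.imp fun _ h n => h n (n + 1)) 1 fun n => h n 1 (by simp)
  have h2 := norm_weightedShift_le (hM.imp fun _ h n => h n (n - 1)) (-1) fun n =>
    h n (-1) (by simp)
  have h3 := norm_weightedShift_le (hM.imp fun _ h n => h n n) 0 fun n => by
    simpa using h n 0 (by simp)
  linarith

lemma tridiagOp_sub {M N : ℤ → ℤ → ℂ} (hM : ∃ C, ∀ j k, ‖M j k‖ ≤ C)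
    (hN : ∃ C, ∀ j k, ‖N j k‖ ≤ C) (h : ∃ C, ∀ j k, ‖M j k - N j k‖ ≤ C) :
    tridiagOp M hM - tridiagOp N hN = tridiagOp (fun j k => M j k - N j k) h := by
  ext u n
  rw [sub_apply, lp.coeFn_sub, Pi.sub_apply, tridiagOp_apply, tridiagOp_apply,
    tridiagOp_apply]
  ring

lemma bounded_sub {M N : ℤ → ℤ → ℂ} (hM : ∃ C, ∀ j k, ‖M j k‖ ≤ C)
    (hN : ∃ C, ∀ j k, ‖N j k‖ ≤ C) : ∃ C, ∀ j k, ‖M j k - N j k‖ ≤ C := by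
  obtain ⟨A, hA⟩ := hM
  obtain ⟨B, hB⟩ := hN
  exact ⟨A + B, fun j k => (norm_sub_le _ _).trans (add_le_add (hA j k) (hB j k))⟩

lemma norm_tridiagOp_sub_le {M N : ℤ → ℤ → ℂ} (hM : ∃ C, ∀ j k, ‖M j k‖ ≤ C)
    (hN : ∃ C, ∀ j k, ‖N j k‖ ≤ C) {C : ℝ} (hC : ∀ j k, |j - k| ≤ 1 → ‖M j k - N j k‖ ≤ C) :
    ‖tridiagOp M hM - tridiagOp N hN‖ ≤ 3 * C := by
  rw [tridiagOp_sub hM hN (bounded_sub hM hN)]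
  exact norm_tridiagOp_le _ hC

/-- The Lax field is the first-order part of the flow, with an error quadratic in `f(J)`. -/
theorem norm_qrFlow_op_sub_le {f : ℝ → ℝ} {J : Jacobi} (h : ‖funCalc f J.op‖ ≤ 1 / 16) :
    ‖(qrFlow f J).op - J.op - laxField f J‖ ≤ 2100 * ‖J.op‖ * ‖funCalc f J.op‖ ^ 2 := by
  rw [Jacobi.op, Jacobi.op, laxField, tridiagOp_sub _ _ (bounded_sub (Jacobi.mat_bdd _)
    (Jacobi.mat_bdd _))]
  -- A tridiagonal operator costs a factor `3` over its entries, one for each diagonal.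
  refine (norm_tridiagOp_sub_le _ _ (C := 700 * ‖J.op‖ * ‖funCalc f J.op‖ ^ 2)
    fun j k hjk => ?_).trans (by rw [Jacobi.op]; linarith)
  rw [qrFlow_mat, laxMat, if_pos hjk]
  exact norm_inner_gsVec_op_sub_le (isSelfAdjoint_funCalc f J.op) h J j k

lemma norm_commEntry_le {A : ℤ → ℤ → ℂ} {J : Jacobi} {C : ℝ} (hA : ∀ j k, ‖A j k‖ ≤ C) (j k : ℤ) :
    ‖commEntry A J j k‖ ≤ 6 * (C * ‖J.op‖) := by
  have hJ : ∀ j k, ‖J.mat j k‖ ≤ ‖J.op‖ := fun j k => by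
    rw [← entry_op]; exact norm_entry_le _ _ _
  have hC : 0 ≤ C := (norm_nonneg _).trans (hA 0 0)
  have h1 : ∀ x y l m : ℤ, ‖A x y * J.mat l m‖ ≤ C * ‖J.op‖ := fun x y l m => by
    rw [norm_mul]
    exact mul_le_mul (hA _ _) (hJ _ _) (norm_nonneg _) hC
  have h2 : ∀ x y l m : ℤ, ‖J.mat l m * A x y‖ ≤ C * ‖J.op‖ := fun x y l m => by
    rw [mul_comm]; exact h1 x y l m
  rw [commEntry, sum_Icc_three, sum_Icc_three]
  refine (norm_sub_le _ _).trans ((add_le_add (norm_add₃_le) (norm_add₃_le)).trans ?_)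
  linarith [h1 j (k + 1) (k + 1) k, h1 j (k - 1) (k - 1) k, h1 j k k k, h2 (j + 1) k j (j + 1),
    h2 (j - 1) k j (j - 1), h2 j k j j]

lemma norm_laxField_le (f : ℝ → ℝ) (J : Jacobi) :
    ‖laxField f J‖ ≤ 18 * (‖funCalc f J.op‖ * ‖J.op‖) := by
  refine (norm_tridiagOp_le _ (C := 6 * (‖funCalc f J.op‖ * ‖J.op‖)) fun j k h => ?_).trans
    (by linarith)
  rw [laxMat, if_pos h]
  exact norm_commEntry_le (norm_antisymm_le _) j k

/-! ### Operator Lipschitz estimates through Fourier series -/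

section OperatorLipschitz

open Complex in
/-- A `C²` function is, on a bounded interval, a Fourier series whose coefficients have a finite
first moment. -/
lemma exists_fourier_series {f : ℝ → ℝ} (hf : ContDiff ℝ 2 f) (R : ℝ) :
    ∃ (c : ℤ → ℂ) (κ : ℝ), Summable (fun n => ‖c n‖) ∧ Summable (fun n : ℤ => |(n : ℝ)| * ‖c n‖) ∧
      ∀ x : ℝ, |x| ≤ R → HasSum (fun n : ℤ => c n * exp (I * ((κ * n * x : ℝ) : ℂ))) (f x : ℂ) := by
  wlog hR : 0 < R generalizing R
  · obtain ⟨c, κ, h1, h2, h3⟩ := this 1 one_pos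
    exact ⟨c, κ, h1, h2, fun x hx => h3 x (by linarith)⟩
  -- The cutoff makes `f` vanish near the ends of the period interval `[-L, L]`, so the periodic
  -- extension is `C²` and integration by parts has no boundary terms.
  let χ : ContDiffBump (0 : ℝ) := ⟨R, R + 1, hR, by linarith⟩
  set L := R + 2 with hL
  set g : ℝ → ℂ := fun x => ((χ x * f x : ℝ) : ℂ) with hg
  have hgR : ∀ x, |x| ≤ R → g x = f x := fun x hx => by
    have : χ x = 1 := χ.one_of_mem_closedBall (by simpa [χ] using hx)
    simp [hg, this]
  have hg2 : ContDiff ℝ 2 g := ofRealCLM.contDiff.comp ((χ.contDiff (n := 2)).mul hf)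
  have hg0 : ∀ x, R + 1 < |x| → g =ᶠ[𝓝 x] 0 := fun x hx => by
    have h1 : ∀ᶠ y in 𝓝 x, R + 1 < |y| := (isOpen_lt continuous_const continuous_abs).mem_nhds hx
    filter_upwards [h1] with y hy
    have : χ y = 0 := χ.zero_of_le_dist (by simpa [χ] using hy.le)
    simp [hg, this]
  have hg1 : ContDiff ℝ 1 (deriv g) := by
    have h : ContDiff ℝ (1 + 1) g := by convert hg2 using 1; norm_num
    exact (contDiff_succ_iff_deriv.1 h).2.2
  have hd1 : ∀ x, HasDerivAt g (deriv g x) x := fun x =>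
    (hg2.differentiable (by norm_num) x).hasDerivAt
  have hd2 : ∀ x, HasDerivAt (deriv g) (deriv (deriv g) x) x := fun x =>
    (hg1.differentiable (by norm_num) x).hasDerivAt
  have hc1 : Continuous (deriv g) := hg1.continuous
  have hc2 : Continuous (deriv (deriv g)) := hg1.continuous_deriv le_rfl
  have hv : ∀ x, R + 1 < |x| → g x = 0 ∧ deriv g x = 0 := fun x hx =>
    ⟨(hg0 x hx).self_of_nhds, by rw [(hg0 x hx).deriv_eq]; simp⟩
  have ha := hv (-L) (by rw [abs_neg, abs_of_pos (by linarith)]; linarith)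
  have hb := hv (-L + 2 * L) (by rw [abs_of_pos (by linarith)]; linarith)
  have hab : -L < -L + 2 * L := by linarith
  have : Fact (0 < 2 * L) := ⟨by linarith⟩
  set c := fourierCoeffOn hab g with hc
  set d := fourierCoeffOn hab (deriv (deriv g)) with hd
  have hd_sq : Summable fun n => ‖d n‖ ^ 2 := by
    have hcs : HasCompactSupport g := by
      refine HasCompactSupport.of_support_subset_isCompact
        (isCompact_Icc (a := -(R + 1)) (b := R + 1)) fun x hx => ?_
      by_contra h
      refine hx (hv x ?_).1
      rw [Set.mem_Icc, ← abs_le, not_le] at h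
      exact h
    exact (hasSum_sq_fourierCoeffOn hab
      ((hc2.memLp_of_hasCompactSupport hcs.deriv.deriv).restrict _)).summable
  -- Two integrations by parts.
  have hcd : ∀ n : ℤ, n ≠ 0 → ‖c n‖ = (2 * L / (2 * Real.pi * |(n : ℝ)|)) ^ 2 * ‖d n‖ := by
    intro n hn
    rw [hc, fourierCoeffOn_of_hasDerivAt hab hn (fun x _ => hd1 x) (hc1.intervalIntegrable _ _),
      fourierCoeffOn_of_hasDerivAt hab hn (fun x _ => hd2 x) (hc2.intervalIntegrable _ _),
      ha.1, ha.2, hb.1, hb.2, ← hd]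
    have h1 : ((-L + 2 * L : ℝ) : ℂ) - ((-L : ℝ) : ℂ) = ((2 * L : ℝ) : ℂ) := by push_cast; ring
    rw [h1]
    simp only [sub_self, mul_zero, zero_sub, norm_mul, norm_neg, norm_div, norm_one, norm_I,
      Complex.norm_real, Real.norm_eq_abs, Complex.norm_intCast, Complex.norm_ofNat]
    rw [abs_of_pos Real.pi_pos, abs_of_pos (by linarith : (0 : ℝ) < L), abs_two]
    have : |(n : ℝ)| ≠ 0 := by simpa using hn
    field_simp
  have hsum1 : Summable fun n : ℤ => |(n : ℝ)| * ‖c n‖ := by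
    set K := (2 * L / (2 * Real.pi)) ^ 2
    have h1 : Summable fun n : ℤ => K * (‖d n‖ ^ 2 + 1 / (n : ℝ) ^ 2) :=
      (hd_sq.add (Real.summable_one_div_int_pow.2 one_lt_two)).mul_left K
    refine Summable.of_nonneg_of_le (fun n => by positivity) (fun n => ?_) h1
    rcases eq_or_ne n 0 with rfl | hn
    · simp; positivity
    have hn' : 0 < |(n : ℝ)| := by simpa using hn
    -- One factor `1/|n|` is left over. The product of the two square summable sequences `‖d n‖` and
    -- `1/|n|` is summable.
    have h2 : |(n : ℝ)| * ‖c n‖ = K * (‖d n‖ * (1 / |(n : ℝ)|)) := by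
      rw [hcd n hn]; simp only [K]; field_simp
    rw [h2]
    gcongr
    rw [← sq_abs (n : ℝ), ← one_div_pow]
    nlinarith [sq_nonneg (‖d n‖ - 1 / |(n : ℝ)|), sq_nonneg ‖d n‖, sq_nonneg (1 / |(n : ℝ)|)]
  have hsum0 : Summable fun n => ‖c n‖ := by
    refine hsum1.of_norm_bounded_eventually ?_
    refine (Set.finite_singleton (0 : ℤ)).subset fun n hn => ?_
    by_contra h0
    refine hn ?_
    change ‖‖c n‖‖ ≤ _
    rw [norm_norm]
    refine le_mul_of_one_le_left (norm_nonneg _) ?_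
    exact_mod_cast Int.one_le_abs h0
  refine ⟨c, 2 * Real.pi / (2 * L), hsum0, hsum1, fun x hx => ?_⟩
  let G : C(AddCircle (2 * L), ℂ) := ⟨AddCircle.liftIco (2 * L) (-L) g,
    AddCircle.liftIco_continuous (by rw [ha.1, hb.1]) hg2.continuous.continuousOn⟩
  have hG : fourierCoeff G = c := funext fun n => fourierCoeff_liftIco_eq g n
  have hGx : G (x : AddCircle (2 * L)) = f x := by
    rw [← hgR x hx]
    obtain ⟨h1, h2⟩ := abs_le.1 hx
    have h3 : x ∈ Set.Ico (-L) (-L + 2 * L) := ⟨by linarith, by linarith⟩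
    exact AddCircle.liftIco_coe_apply (f := g) h3
  have := has_pointwise_sum_fourier_series_of_summable (f := G) (by rw [hG]; exact hsum0.of_norm)
    (x : AddCircle (2 * L))
  rw [hG, hGx] at this
  convert this using 2 with n
  rw [fourier_coe_apply, smul_eq_mul]
  congr 2
  push_cast
  field_simp

variable {H : Type*} [NormedAddCommGroup H] [InnerProductSpace ℂ H] [CompleteSpace H]

lemma norm_exp_mul_mul_exp {A B : H →L[ℂ] H} (hA : IsSelfAdjoint A) (hB : IsSelfAdjoint B)
    (X : H →L[ℂ] H) :
    ‖NormedSpace.exp (Complex.I • A) * X * NormedSpace.exp (Complex.I • B)‖ = ‖X‖ := by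
  have h := CStarRing.norm_mul_coe_unitary
    ((selfAdjoint.expUnitary ⟨A, hA⟩ : unitary (H →L[ℂ] H)) * X) (selfAdjoint.expUnitary ⟨B, hB⟩)
  rw [CStarRing.norm_coe_unitary_mul] at h
  exact h

/-- The exponentials of skew-adjoint operators depend on them with Lipschitz constant one. -/
lemma norm_exp_sub_exp_le {A B : H →L[ℂ] H} (hA : IsSelfAdjoint A) (hB : IsSelfAdjoint B) :
    ‖NormedSpace.exp (Complex.I • A) - NormedSpace.exp (Complex.I • B)‖ ≤ ‖A - B‖ := by
  set X := Complex.I • A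
  set Y := Complex.I • B
  -- Duhamel interpolation between the two exponentials. Both outer factors of the derivative are
  -- unitary, so its norm is `‖X - Y‖ = ‖A - B‖`.
  have hd : ∀ s : ℝ, HasDerivAt
      (fun s : ℝ => NormedSpace.exp (s • X) * NormedSpace.exp ((1 - s) • Y))
      (NormedSpace.exp (s • X) * (X - Y) * NormedSpace.exp ((1 - s) • Y)) s := by
    intro s
    have h1 := hasDerivAt_exp_smul_const (𝕂 := ℝ) X s
    have h2 := (hasDerivAt_exp_smul_const' (𝕂 := ℝ) Y (1 - s)).scomp s
      ((hasDerivAt_id s).const_sub 1)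
    refine (h1.mul h2).congr_deriv ?_
    simp only [neg_smul, one_smul, Function.comp_apply]
    noncomm_ring
  have hb : ∀ s : ℝ, ‖NormedSpace.exp (s • X) * (X - Y) * NormedSpace.exp ((1 - s) • Y)‖
      ≤ ‖A - B‖ := by
    intro s
    have h1 : s • X = Complex.I • (s • A) := smul_comm _ _ _
    have h2 : (1 - s) • Y = Complex.I • ((1 - s) • B) := smul_comm _ _ _
    rw [h1, h2, norm_exp_mul_mul_exp ((IsSelfAdjoint.all s).smul hA)
      ((IsSelfAdjoint.all (1 - s)).smul hB), ← smul_sub, norm_smul, Complex.norm_I, one_mul]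
  have := (convex_univ (𝕜 := ℝ) (E := ℝ)).norm_image_sub_le_of_norm_hasDerivWithin_le
    (fun s _ => (hd s).hasDerivWithinAt) (fun s _ => hb s) (Set.mem_univ 0) (Set.mem_univ 1)
  simpa using this

/-- The series converges uniformly on the spectrum by the Weierstrass test, and the functional
calculus is continuous under uniform convergence. Since the summands are complex valued, the
calculus over `ℂ` is used, with `f` extended as `z ↦ f (re z)`. -/
lemma hasSum_funCalc {f : ℝ → ℝ} {c : ℤ → ℂ} {κ R : ℝ} (hc : Summable fun n => ‖c n‖)
    (h : ∀ x : ℝ, |x| ≤ R →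
      HasSum (fun n : ℤ => c n * Complex.exp (Complex.I * ((κ * n * x : ℝ) : ℂ))) (f x : ℂ))
    {A : H →L[ℂ] H} (hA : IsSelfAdjoint A) (hR : ‖A‖ ≤ R) :
    HasSum (fun n : ℤ => c n • NormedSpace.exp (Complex.I • ((κ * n : ℝ) • A))) (funCalc f A) := by
  rcases subsingleton_or_nontrivial (H →L[ℂ] H) with hs | hs
  · convert hasSum_zero using 1
  have := hA.isStarNormal
  set e : ℤ → ℂ → ℂ := fun n z => c n * Complex.exp (Complex.I * (κ * n : ℝ) * z) with he
  have hspec : ∀ z ∈ spectrum ℂ A, z = (z.re : ℂ) ∧ |z.re| ≤ R := fun z hz =>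
    ⟨hA.mem_spectrum_eq_re hz,
      (Complex.abs_re_le_norm z).trans ((spectrum.norm_le_norm_of_mem hz).trans hR)⟩
  have hez : ∀ n, ∀ z ∈ spectrum ℂ A,
      e n z = c n * Complex.exp (Complex.I * ((κ * n * z.re : ℝ) : ℂ)) := fun n z hz => by
    conv_lhs => rw [(hspec z hz).1]
    simp only [he]
    congr 2
    push_cast; ring
  have hcont : ∀ n, Continuous (e n) := fun n => by fun_prop
  have h1 : TendstoUniformlyOn (fun (s : Finset ℤ) z => ∑ n ∈ s, e n z)
      (fun z => (f z.re : ℂ)) atTop (spectrum ℂ A) := by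
    refine (tendstoUniformlyOn_tsum hc fun n z hz => ?_).congr_right fun z hz => ?_
    · rw [hez n z hz, norm_mul, mul_comm Complex.I, Complex.norm_exp_ofReal_mul_I, mul_one]
    · simp only [hez _ z hz]
      exact (h _ (hspec z hz).2).tsum_eq
  have h2 := tendsto_cfc_fun (a := A) h1 (Eventually.of_forall fun s =>
    (continuous_finsetSum s fun n _ => hcont n).continuousOn)
  have h3 : cfc (fun z : ℂ => (f z.re : ℂ)) A = funCalc f A := (cfc_real_eq_complex f hA).symm
  rw [h3] at h2
  have h4 : ∀ n, cfc (e n) A = c n • NormedSpace.exp (Complex.I • ((κ * n : ℝ) • A)) := by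
    intro n
    have h5 : Complex.I • ((κ * n : ℝ) • A) = (Complex.I * (κ * n : ℝ)) • A := by
      rw [← Complex.coe_smul, smul_smul]
    rw [h5, he, cfc_const_mul _ _ A (by fun_prop),
      cfc_comp_const_mul (Complex.I * (κ * n : ℝ)) Complex.exp A (by fun_prop) (by cfc_tac),
      CFC.complex_exp_eq_normedSpace_exp (a := (Complex.I * (κ * n : ℝ)) • A)]
  refine h2.congr fun s => ?_
  rw [← Finset.sum_congr rfl fun n _ => h4 n, ← cfc_sum e A s fun n _ => (hcont n).continuousOn]
  congr 1
  ext z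
  rw [Finset.sum_apply]

/-- A `C²` function is operator Lipschitz on bounded sets. -/
theorem exists_lipschitz_funCalc {f : ℝ → ℝ} (hf : ContDiff ℝ 2 f) (R : ℝ) :
    ∃ L : ℝ, 0 ≤ L ∧ ∀ A B : H →L[ℂ] H, IsSelfAdjoint A → IsSelfAdjoint B → ‖A‖ ≤ R → ‖B‖ ≤ R →
      ‖funCalc f A - funCalc f B‖ ≤ L * ‖A - B‖ := by
  obtain ⟨c, κ, h0, h1, h2⟩ := exists_fourier_series hf R
  refine ⟨∑' n : ℤ, |κ| * (|(n : ℝ)| * ‖c n‖), tsum_nonneg fun n => by positivity,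
    fun A B hA hB hAR hBR => ?_⟩
  have h3 := (hasSum_funCalc h0 h2 hA hAR).sub (hasSum_funCalc h0 h2 hB hBR)
  refine h3.norm_le_of_bounded ((h1.mul_left |κ|).hasSum.mul_right ‖A - B‖) fun n => ?_
  rw [← smul_sub, norm_smul]
  have h4 := norm_exp_sub_exp_le ((IsSelfAdjoint.all (κ * n : ℝ)).smul hA)
    ((IsSelfAdjoint.all (κ * n : ℝ)).smul hB)
  rw [← smul_sub, norm_smul, Real.norm_eq_abs, abs_mul] at h4
  calc _ ≤ ‖c n‖ * (|κ| * |(n : ℝ)| * ‖A - B‖) := by gcongr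
    _ = _ := by ring

end OperatorLipschitz

/-! ### Lipschitz dependence of the Lax field -/

section LaxField

lemma antisymm_smul (t : ℝ) (X : Ell2 →L[ℂ] Ell2) (j k : ℤ) :
    antisymm ((t : ℂ) • X) j k = t * antisymm X j k := by
  have h : ∀ j k, entry ((t : ℂ) • X) j k = t * entry X j k := fun j k => by
    simp only [entry, inner_delta_left]
    rfl
  unfold antisymm
  simp only [h]
  split_ifs <;> ring

lemma antisymm_sub (X Y : Ell2 →L[ℂ] Ell2) (j k : ℤ) :
    antisymm X j k - antisymm Y j k = antisymm (X - Y) j k := by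
  have h : ∀ j k, entry (X - Y) j k = entry X j k - entry Y j k := fun j k => by
    simp only [entry, sub_apply, inner_sub_right]
  unfold antisymm
  simp only [h]
  split_ifs <;> ring

lemma laxField_smul {f : ℝ → ℝ} (hf : Continuous f) (t : ℝ) (J : Jacobi) :
    laxField (t • f) J = (t : ℂ) • laxField f J := by
  have h : ∀ j k, laxMat (t • f) J j k = t * laxMat f J j k := fun j k => by
    simp only [laxMat, commEntry, funCalc_smul hf, antisymm_smul]
    split_ifs
    · rw [mul_sub, Finset.mul_sum, Finset.mul_sum]
      congr 1 <;> exact Finset.sum_congr rfl fun _ _ => by ring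
    · rw [mul_zero]
  ext u n
  have h1 : ((t : ℂ) • laxField f J) u n = (t : ℂ) * laxField f J u n := rfl
  rw [h1, laxField, laxField, tridiagOp_apply, tridiagOp_apply, h, h, h]
  ring

lemma norm_commEntry_sub_le {A B : ℤ → ℤ → ℂ} {J K : Jacobi} {c d : ℝ}
    (hAB : ∀ j k, ‖A j k - B j k‖ ≤ c) (hB : ∀ j k, ‖B j k‖ ≤ d) (j k : ℤ) :
    ‖commEntry A J j k - commEntry B K j k‖ ≤ 6 * (c * ‖J.op‖ + d * ‖J.op - K.op‖) := by
  have hJ : ∀ j k, ‖J.mat j k‖ ≤ ‖J.op‖ := fun j k => by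
    rw [← entry_op]; exact norm_entry_le _ _ _
  have hJK : ∀ j k, ‖J.mat j k - K.mat j k‖ ≤ ‖J.op - K.op‖ := fun j k => by
    have : J.mat j k - K.mat j k = entry (J.op - K.op) j k := by
      rw [← entry_op, ← entry_op]; simp only [entry, sub_apply, inner_sub_right]
    rw [this]; exact norm_entry_le _ _ _
  have hc : 0 ≤ c := (norm_nonneg _).trans (hAB 0 0)
  have hd : 0 ≤ d := (norm_nonneg _).trans (hB 0 0)
  set e := c * ‖J.op‖ + d * ‖J.op - K.op‖
  have h1 : ∀ x y l m : ℤ, ‖A x y * J.mat l m - B x y * K.mat l m‖ ≤ e := fun x y l m => by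
    have : A x y * J.mat l m - B x y * K.mat l m
        = (A x y - B x y) * J.mat l m + B x y * (J.mat l m - K.mat l m) := by ring
    rw [this]
    refine (norm_add_le _ _).trans (add_le_add ?_ ?_)
    · rw [norm_mul]; exact mul_le_mul (hAB _ _) (hJ _ _) (norm_nonneg _) hc
    · rw [norm_mul]; exact mul_le_mul (hB _ _) (hJK _ _) (norm_nonneg _) hd
  have h2 : commEntry A J j k - commEntry B K j k
      = ((A j (k + 1) * J.mat (k + 1) k - B j (k + 1) * K.mat (k + 1) k)
        + (A j (k - 1) * J.mat (k - 1) k - B j (k - 1) * K.mat (k - 1) k)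
        + (A j k * J.mat k k - B j k * K.mat k k))
      - ((A (j + 1) k * J.mat j (j + 1) - B (j + 1) k * K.mat j (j + 1))
        + (A (j - 1) k * J.mat j (j - 1) - B (j - 1) k * K.mat j (j - 1))
        + (A j k * J.mat j j - B j k * K.mat j j)) := by
    rw [commEntry, commEntry, sum_Icc_three, sum_Icc_three, sum_Icc_three, sum_Icc_three]
    ring
  rw [h2]
  refine (norm_sub_le _ _).trans ((add_le_add norm_add₃_le norm_add₃_le).trans ?_)
  linarith [h1 j (k + 1) (k + 1) k, h1 j (k - 1) (k - 1) k, h1 j k k k, h1 (j + 1) k j (j + 1),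
    h1 (j - 1) k j (j - 1), h1 j k j j]

lemma norm_laxField_sub_le (f : ℝ → ℝ) (J K : Jacobi) :
    ‖laxField f J - laxField f K‖ ≤ 18 * (‖funCalc f J.op - funCalc f K.op‖ * ‖J.op‖
      + ‖funCalc f K.op‖ * ‖J.op - K.op‖) := by
  refine (norm_tridiagOp_sub_le (laxMat_bdd f J) (laxMat_bdd f K)
    (C := 6 * (‖funCalc f J.op - funCalc f K.op‖ * ‖J.op‖
      + ‖funCalc f K.op‖ * ‖J.op - K.op‖)) fun j k h => ?_).trans (by linarith)
  rw [laxMat, laxMat, if_pos h, if_pos h]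
  exact norm_commEntry_sub_le (fun j k => by rw [antisymm_sub]; exact norm_antisymm_le _ _ _)
    (norm_antisymm_le _) j k

/-- For `f ∈ C²`, the Lax field is Lipschitz on bounded sets. -/
lemma exists_lipschitz_laxField {f : ℝ → ℝ} (hf : ContDiff ℝ 2 f) (R : ℝ) :
    ∃ C : ℝ, ∀ J K : Jacobi, ‖J.op‖ ≤ R → ‖K.op‖ ≤ R →
      ‖laxField f J - laxField f K‖ ≤ C * ‖J.op - K.op‖ := by
  obtain ⟨L, hL0, hL⟩ := exists_lipschitz_funCalc (H := Ell2) hf R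
  refine ⟨18 * (L * R + (L * R + ‖funCalc f (0 : Ell2 →L[ℂ] Ell2)‖)), fun J K hJ hK => ?_⟩
  have h1 := hL _ _ (isSelfAdjoint_op J) (isSelfAdjoint_op K) hJ hK
  have h2 := hL _ 0 (isSelfAdjoint_op K) (IsSelfAdjoint.zero _) hK
    (by rw [norm_zero]; exact (norm_nonneg _).trans hK)
  rw [sub_zero] at h2
  have h3 : ‖funCalc f K.op‖ ≤ L * R + ‖funCalc f (0 : Ell2 →L[ℂ] Ell2)‖ := by
    have h4 := norm_le_norm_add_norm_sub' (funCalc f K.op) (funCalc f (0 : Ell2 →L[ℂ] Ell2))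
    have h5 : L * ‖K.op‖ ≤ L * R := by gcongr
    linarith
  refine (norm_laxField_sub_le f J K).trans ?_
  calc _ ≤ 18 * (L * ‖J.op - K.op‖ * R
        + (L * R + ‖funCalc f (0 : Ell2 →L[ℂ] Ell2)‖) * ‖J.op - K.op‖) := by gcongr
    _ = _ := by ring

end LaxField

/-! ### Existence and uniqueness for the Lax equation -/

section Solutions

/-- The flow defined by Gram-Schmidt factorization solves the Lax equation. -/
theorem isLaxSolution_qrFlow {f : ℝ → ℝ} (hf : Continuous f) (J : Jacobi) :
    IsLaxSolution f J fun t => qrFlow (t • f) J := by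
  refine ⟨by simp only [zero_smul, qrFlow_zero], fun t => ?_⟩
  set K := qrFlow (t • f) J with hK
  set F := ‖funCalc f K.op‖ with hF
  -- The group law restarts the flow at time `t`, so only the expansion around time zero is needed.
  have hstep : ∀ s, qrFlow (s • f) J = qrFlow ((s - t) • f) K := fun s => by
    rw [hK, qrFlow_qrFlow (hf.const_smul _) (hf.const_smul _), ← add_smul, sub_add_cancel]
  have hnorm : ∀ h : ℝ, ‖funCalc (h • f) K.op‖ = |h| * F := fun h => by
    rw [funCalc_smul hf, norm_smul, Complex.norm_real, Real.norm_eq_abs]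
  rw [hasDerivAt_iff_isLittleO]
  have hO : (fun s => (qrFlow (s • f) J).op - (qrFlow (t • f) J).op - (s - t) • laxField f K)
      =O[𝓝 t] fun s => (s - t) ^ 2 := by
    refine Asymptotics.IsBigO.of_bound (2100 * ‖K.op‖ * F ^ 2) ?_
    have h1 : ∀ᶠ s in 𝓝 t, |s - t| * F < 1 / 16 := by
      have : Tendsto (fun s => |s - t| * F) (𝓝 t) (𝓝 (|t - t| * F)) :=
        Continuous.tendsto (by fun_prop) t
      rw [sub_self, abs_zero, zero_mul] at this
      exact this.eventually_lt_const (by norm_num)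
    filter_upwards [h1] with s hs
    have h2 : (s - t) • laxField f K = laxField ((s - t) • f) K := by
      rw [laxField_smul hf]
      ext u n
      exact Complex.real_smul
    rw [hstep s, ← hK, h2]
    refine (norm_qrFlow_op_sub_le (by rw [hnorm]; exact hs.le)).trans (le_of_eq ?_)
    rw [hnorm, mul_pow, norm_pow, Real.norm_eq_abs]
    ring
  exact hO.trans_isLittleO (by
    simpa using (Asymptotics.isLittleO_pow_sub_sub t one_lt_two).norm_left)

lemma eq_zero_of_norm_deriv_le {E : Type*} [NormedAddCommGroup E] [NormedSpace ℝ E] {D D' : ℝ → E}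
    (hD : ∀ t, HasDerivAt D (D' t) t) (h0 : D 0 = 0)
    (hK : ∀ T : ℝ, ∃ K : ℝ, ∀ t, |t| ≤ T → ‖D' t‖ ≤ K * ‖D t‖) (t : ℝ) : D t = 0 := by
  -- Negative times follow by time reversal.
  wlog ht : 0 ≤ t generalizing D D' t
  · have := this (D := fun s => D (-s)) (D' := fun s => -D' (-s)) (fun s => by
      simpa [Function.comp_def] using (hD (-s)).scomp s (hasDerivAt_neg s)) (by simpa using h0) (fun T => by
      obtain ⟨K, hK⟩ := hK T
      exact ⟨K, fun s hs => by rw [norm_neg]; exact hK _ (by rwa [abs_neg])⟩) (-t) (by linarith)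
    simpa using this
  obtain ⟨K, hK⟩ := hK t
  exact eq_zero_of_abs_deriv_le_mul_abs_self_of_eq_zero_right (a := 0) (b := t)
    (fun s _ => (hD s).continuousAt.continuousWithinAt) (fun s _ => (hD s).hasDerivWithinAt) h0
    (fun s hs => hK s (by rw [abs_of_nonneg hs.1]; exact hs.2.le)) t ⟨ht, le_rfl⟩

theorem IsLaxSolution.unique {f : ℝ → ℝ} (hf : ContDiff ℝ 2 f) {J : Jacobi} {γ δ : ℝ → Jacobi}
    (hγ : IsLaxSolution f J γ) (hδ : IsLaxSolution f J δ) : γ = δ := by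
  funext t
  refine op_injective (sub_eq_zero.1 ?_)
  refine eq_zero_of_norm_deriv_le (fun s => (hγ.2 s).sub (hδ.2 s))
    (by rw [Pi.sub_apply, hγ.1, hδ.1, sub_self]) (fun T => ?_) t
  -- Continuity bounds each solution on a compact time interval, so a single Lipschitz constant
  -- serves for both there.
  have hb : ∀ {γ : ℝ → Jacobi}, IsLaxSolution f J γ → ∃ R, ∀ s, |s| ≤ T → ‖(γ s).op‖ ≤ R := by
    intro γ hγ
    have hc : Continuous fun s => (γ s).op :=
      continuous_iff_continuousAt.2 fun s => (hγ.2 s).continuousAt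
    obtain ⟨R, hR⟩ := isCompact_Icc.exists_bound_of_continuousOn (s := Set.Icc (-T) T)
      hc.continuousOn
    exact ⟨R, fun s hs => hR s (abs_le.1 hs)⟩
  obtain ⟨R₁, h₁⟩ := hb hγ
  obtain ⟨R₂, h₂⟩ := hb hδ
  obtain ⟨C, hC⟩ := exists_lipschitz_laxField hf (max R₁ R₂)
  exact ⟨C, fun s hs => hC _ _ ((h₁ s hs).trans (le_max_left _ _))
    ((h₂ s hs).trans (le_max_right _ _))⟩

theorem existsUnique_isLaxSolution {f : ℝ → ℝ} (hf : ContDiff ℝ 2 f) (J : Jacobi) :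
    ∃! γ : ℝ → Jacobi, IsLaxSolution f J γ :=
  ⟨_, isLaxSolution_qrFlow hf.continuous J, fun _ h =>
    h.unique hf (isLaxSolution_qrFlow hf.continuous J)⟩

theorem todaFlow_eq {f : ℝ → ℝ} (hf : ContDiff ℝ 2 f) {J : Jacobi} {γ : ℝ → Jacobi}
    (h : IsLaxSolution f J γ) (t : ℝ) : todaFlow f t J = γ t := by
  have hex : ∃ γ : ℝ → Jacobi, IsLaxSolution f J γ := ⟨γ, h⟩
  rw [todaFlow, dif_pos hex, hex.choose_spec.unique hf h]

theorem todaFlow_eq_qrFlow {f : ℝ → ℝ} (hf : ContDiff ℝ 2 f) (t : ℝ) (J : Jacobi) :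
    todaFlow f t J = qrFlow (t • f) J :=
  todaFlow_eq hf (isLaxSolution_qrFlow hf.continuous J) t

theorem act_eq_qrFlow {f : ℝ → ℝ} (hf : ContDiff ℝ 2 f) (J : Jacobi) : act f J = qrFlow f J := by
  rw [act, todaFlow_eq_qrFlow hf, one_smul]

end Solutions

/-! ### Continuity in the function -/

section Continuity

lemma tendsto_qrFlow_op {f : ℝ → ℝ} {fn : ℕ → ℝ → ℝ} (hf : Continuous f)
    (hfn : ∀ n, Continuous (fn n)) (J : Jacobi)
    (h : TendstoUniformlyOn fn f atTop {x : ℝ | |x| ≤ ‖J.op‖}) :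
    Tendsto (fun n => (qrFlow (fn n) J).op) atTop (𝓝 (qrFlow f J).op) := by
  set K := qrFlow f J with hK
  set ε : ℕ → ℝ := fun n => ‖funCalc (fn n - f) K.op‖ with hε
  -- By the group law, `f_n · J` is the image of `K = f · J` under the flow of the small function
  -- `f_n - f`.
  have hstep : ∀ n, qrFlow (fn n) J = qrFlow (fn n - f) K := fun n => by
    rw [hK, qrFlow_qrFlow ((hfn n).sub hf) hf, sub_add_cancel]
  have hlim : Tendsto ε atTop (𝓝 0) := by
    rw [Metric.tendsto_atTop]
    intro r hr
    obtain ⟨N, hN⟩ := eventually_atTop.1 (Metric.tendstoUniformlyOn_iff.1 h (r / 2) (half_pos hr))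
    refine ⟨N, fun n hn => ?_⟩
    rw [Real.dist_eq, sub_zero, abs_of_nonneg (norm_nonneg _)]
    refine lt_of_le_of_lt (norm_funCalc_le (half_pos hr).le fun x hx => ?_) (half_lt_self hr)
    -- The flow conserves the norm, so uniform convergence on `|x| ≤ ‖J‖` is what the bound at `K`
    -- requires.
    rw [hK, norm_qrFlow_op] at hx
    have := (hN n hn x hx).le
    rwa [dist_comm, Real.dist_eq] at this
  rw [tendsto_iff_norm_sub_tendsto_zero]
  have hbound : ∀ᶠ n in atTop, ‖(qrFlow (fn n) J).op - K.op‖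
      ≤ 2100 * ‖K.op‖ * ε n ^ 2 + 18 * (ε n * ‖K.op‖) := by
    filter_upwards [hlim.eventually_le_const (by norm_num : (0 : ℝ) < 1 / 16)] with n hn
    have h1 := norm_qrFlow_op_sub_le (J := K) hn
    have h2 := norm_laxField_le (fn n - f) K
    rw [hstep n]
    calc _ = ‖((qrFlow (fn n - f) K).op - K.op - laxField (fn n - f) K)
          + laxField (fn n - f) K‖ := by rw [sub_add_cancel]
      _ ≤ _ := (norm_add_le _ _).trans (add_le_add h1 h2)
  refine squeeze_zero' (Eventually.of_forall fun n => norm_nonneg _) hbound ?_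
  have := ((hlim.pow 2).const_mul (2100 * ‖K.op‖)).add ((hlim.mul_const ‖K.op‖).const_mul 18)
  simpa using this

end Continuity

/-! ### Commutation with the shift -/

section Shift

lemma bounded_one : ∃ C : ℝ, ∀ _ : ℤ, ‖(1 : ℂ)‖ ≤ C := ⟨1, fun _ => by simp⟩

/-- The unitary shift `(S u)_n = u_{n+m}`. -/
def shiftUnitary (m : ℤ) : Ell2 ≃ₗᵢ[ℂ] Ell2 where
  toFun := weightedShift (fun _ => 1) bounded_one m
  invFun := weightedShift (fun _ => 1) bounded_one (-m)
  map_add' := map_add _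
  map_smul' := map_smul _
  left_inv u := by ext n; simp [weightedShift_apply]
  right_inv u := by ext n; simp [weightedShift_apply]
  norm_map' u := by
    refine (sq_eq_sq₀ (norm_nonneg _) (norm_nonneg _)).1 ?_
    rw [norm_sq_eq, norm_sq_eq, ← (Equiv.addRight m).tsum_eq (fun n : ℤ => ‖u n‖ ^ 2)]
    refine tsum_congr fun n => ?_
    change ‖(1 : ℂ) * u (n + m)‖ ^ 2 = _
    rw [one_mul]; rfl

lemma shiftUnitary_apply (m : ℤ) (u : Ell2) (n : ℤ) : shiftUnitary m u n = u (n + m) :=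
  one_mul (u (n + m))

lemma shiftUnitary_symm_apply (m : ℤ) (u : Ell2) (n : ℤ) : (shiftUnitary m).symm u n = u (n - m) :=
  one_mul (u (n - m))

lemma conj_shiftUnitary_apply (m : ℤ) (X : Ell2 →L[ℂ] Ell2) (u : Ell2) (n : ℤ) :
    (shiftUnitary m).conjStarAlgEquiv X u n = X ((shiftUnitary m).symm u) (n + m) :=
  shiftUnitary_apply _ _ _

lemma shiftUnitary_symm_delta (m k : ℤ) : (shiftUnitary m).symm (delta k) = delta (k + m) := by
  ext n
  rw [shiftUnitary_symm_apply, delta_apply, delta_apply]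
  simp only [sub_eq_iff_eq_add]

lemma entry_conj_shiftUnitary (m : ℤ) (X : Ell2 →L[ℂ] Ell2) (j k : ℤ) :
    entry ((shiftUnitary m).conjStarAlgEquiv X) j k = entry X (j + m) (k + m) := by
  rw [entry, entry, inner_delta_left, inner_delta_left, conj_shiftUnitary_apply,
    shiftUnitary_symm_delta]

lemma tridiagOp_shift (m : ℤ) {M N : ℤ → ℤ → ℂ} (hM : ∃ C, ∀ j k, ‖M j k‖ ≤ C)
    (hN : ∃ C, ∀ j k, ‖N j k‖ ≤ C) (h : ∀ j k, N j k = M (j + m) (k + m)) :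
    tridiagOp N hN = (shiftUnitary m).conjStarAlgEquiv (tridiagOp M hM) := by
  ext u n
  rw [conj_shiftUnitary_apply, tridiagOp_apply, tridiagOp_apply, shiftUnitary_symm_apply,
    shiftUnitary_symm_apply, shiftUnitary_symm_apply, h, h, h]
  have h1 : n + 1 + m = n + m + 1 := by ring
  have h2 : n - 1 + m = n + m - 1 := by ring
  have h3 : n + m + 1 - m = n + 1 := by ring
  have h4 : n + m - 1 - m = n - 1 := by ring
  rw [h1, h2, h3, h4, add_sub_cancel_right]

lemma shift_mat (m : ℤ) (J : Jacobi) (j k : ℤ) : (J.shift m).mat j k = J.mat (j + m) (k + m) := by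
  unfold Jacobi.mat Jacobi.shift
  split_ifs <;> first | omega | rfl

lemma shift_op (m : ℤ) (J : Jacobi) : (J.shift m).op = (shiftUnitary m).conjStarAlgEquiv J.op :=
  tridiagOp_shift m _ _ (shift_mat m J)

lemma laxField_shift {f : ℝ → ℝ} (hf : Continuous f) (m : ℤ) (J : Jacobi) :
    laxField f (J.shift m) = (shiftUnitary m).conjStarAlgEquiv (laxField f J) := by
  refine tridiagOp_shift m _ _ fun j k => ?_
  have h : ∀ j k, antisymm (funCalc f (J.shift m).op) j k
      = antisymm (funCalc f J.op) (j + m) (k + m) := fun j k => by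
    simp only [antisymm, shift_op, funCalc_conj _ hf (isSelfAdjoint_op J),
      entry_conj_shiftUnitary, add_lt_add_iff_right]
  have h1 : ∀ n, n + 1 + m = n + m + 1 := fun n => by ring
  have h2 : ∀ n, n - 1 + m = n + m - 1 := fun n => by ring
  simp only [laxMat, commEntry, sum_Icc_three, h, shift_mat, add_sub_add_right_eq_sub, h1, h2]

/-- The shift is conjugation by a unitary that preserves the order of the basis, so it respects
`f(J)` and its antisymmetric part. Conjugation is linear and continuous, hence passes through the
derivative. -/
lemma IsLaxSolution.shift {f : ℝ → ℝ} (hf : Continuous f) {J : Jacobi} {γ : ℝ → Jacobi}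
    (h : IsLaxSolution f J γ) (m : ℤ) :
    IsLaxSolution f (J.shift m) fun t => (γ t).shift m := by
  refine ⟨congrArg (Jacobi.shift m) h.1, fun t => ?_⟩
  simp_rw [shift_op, laxField_shift hf]
  exact ((AddMonoidHomClass.toAddMonoidHom (shiftUnitary m).conjStarAlgEquiv).toRealLinearMap
    (continuous_conj _)).hasFDerivAt.comp_hasDerivAt t (h.2 t)

end Shift

end Toda

end

/-- Global solvability (so that `f · J` is meaningful), continuity of `f ↦ f · J` with respect to
uniform convergence on `[-‖J‖, ‖J‖]`, and commutation of the flows with each other and with the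
shift, so that `C²(ℝ) × ℤ` acts on the Jacobi matrices. -/
theorem theorem2p2 :
    (∀ f : ℝ → ℝ, ContDiff ℝ 2 f → ∀ J : Toda.Jacobi,
      ∃! γ : ℝ → Toda.Jacobi, Toda.IsLaxSolution f J γ) ∧
    (∀ (J : Toda.Jacobi) (f : ℝ → ℝ) (fn : ℕ → ℝ → ℝ),
      ContDiff ℝ 2 f → (∀ n, ContDiff ℝ 2 (fn n)) →
      TendstoUniformlyOn fn f atTop {x : ℝ | |x| ≤ ‖J.op‖} →
      Tendsto (fun n => (Toda.act (fn n) J).op) atTop (𝓝 (Toda.act f J).op)) ∧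
    (∀ f g : ℝ → ℝ, ContDiff ℝ 2 f → ContDiff ℝ 2 g → ∀ (s t : ℝ) (J : Toda.Jacobi),
      Toda.todaFlow f s (Toda.todaFlow g t J) = Toda.todaFlow g t (Toda.todaFlow f s J)) ∧
    (∀ f : ℝ → ℝ, ContDiff ℝ 2 f → ∀ (t : ℝ) (m : ℤ) (J : Toda.Jacobi),
      Toda.todaFlow f t (J.shift m) = (Toda.todaFlow f t J).shift m) ∧
    (∀ J : Toda.Jacobi, Toda.act 0 J = J) ∧
    (∀ f g : ℝ → ℝ, ContDiff ℝ 2 f → ContDiff ℝ 2 g → ∀ J : Toda.Jacobi,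
      Toda.act (f + g) J = Toda.act f (Toda.act g J)) := by
  have hsm : ∀ (t : ℝ) {f : ℝ → ℝ}, ContDiff ℝ 2 f → Continuous (t • f) :=
    fun t f hf => hf.continuous.const_smul t
  refine ⟨fun f hf J => Toda.existsUnique_isLaxSolution hf J, ?_, ?_, ?_, ?_, ?_⟩
  · intro J f fn hf hfn h
    simp only [Toda.act_eq_qrFlow hf, Toda.act_eq_qrFlow (hfn _)]
    exact Toda.tendsto_qrFlow_op hf.continuous (fun n => (hfn n).continuous) J h
  · intro f g hf hg s t J
    simp only [Toda.todaFlow_eq_qrFlow hf, Toda.todaFlow_eq_qrFlow hg]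
    rw [Toda.qrFlow_qrFlow (hsm s hf) (hsm t hg), Toda.qrFlow_qrFlow (hsm t hg) (hsm s hf),
      add_comm]
  · intro f hf t m J
    rw [Toda.todaFlow_eq_qrFlow hf t J]
    exact Toda.todaFlow_eq hf
      ((Toda.isLaxSolution_qrFlow hf.continuous J).shift hf.continuous m) t
  · intro J
    rw [Toda.act_eq_qrFlow (f := 0) contDiff_const, Toda.qrFlow_zero]
  · intro f g hf hg J
    rw [Toda.act_eq_qrFlow (f := f + g) (hf.add hg), Toda.act_eq_qrFlow hf, Toda.act_eq_qrFlow hg,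
      Toda.qrFlow_qrFlow hf.continuous hg.continuous]
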